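/- Let $(W,S)$ be a finite Coxeter system with length function $\ell$ and Coxeter matrix $m$, and let $\mathbb K$ be a field. The $0$-Hecke algebra $H_W(0)$ is the associative unital $\mathbb K$-algebra generated by $\{\pi_s : s\in S\}$ subject to $\pi_s^2=\pi_s$ and $\pi_s\pi_t\pi_s\cdots=\pi_t\pi_s\pi_t\cdots$ ($m(s,t)$ factors on each side) for all distinct $s,t\in S$. For $w\in W$ let $D_L(w)=\{s\in S:\ell(sw)<\ell(w)\}$ and $D_R(w)=\{s\in S:\ell(ws)<\ell(w)\}$. For $I\subseteq S$ let $\mathcal D_I=\{w\in W: D_R(w)=I\}$, and let $u_I$ and $v_I$ be the (unique) shortest and longest elements of $\mathcal D_I$. The left weak order is given by $u\le_L v$ if $v=s_1\cdots s_k u$ for some $s_1,\dots,s_k\in S$ with $\ell(v)=\ell(u)+k$, and $[u,v]_L=\{x\in W: u\le_L x\le_L v\}$. For $u\le_L v$ the weak Bruhat interval module ${\rm B}(u,v)$ is the left $H_W(0)$-module with $\mathbb K$-basis $[u,v]_L$ and action $$\pi_s\cdot x=\begin{cases}x & \text{if } s\in D_L(x),\\ sx & \text{if } s\notin D_L(x)\text{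 and } sx\in[u,v]_L,\\ 0 & \text{if } s\notin D_L(x)\text{ and } sx\notin[u,v]_L.\end{cases}$$ For $I\subseteq J\subseteq S$ put ${\rm P}_I^J={\rm B}(u_I,v_J)$ and ${\rm P}_I={\rm P}_I^I$. A projective cover of a module $M$ is a projective module $P$ for which there is an epimorphism $f:P\to M$ with superfluous kernel (that is, $\ker f+L=P$ implies $L=P$ for every submodule $L$ of $P$). A module is indecomposable if it is nonzero and is not the direct sum of two nonzero submodules. Let $I\subseteq J\subseteq S$ and $w\in\mathcal D_J$. Then: 1. ${\rm P}_I^J\cong\bigoplus_{I\subseteq X\subseteq J}{\rm P}_X$ as $H_W(0)$-modules; 2. ${\rm P}_I^J$ is the projective cover of ${\rm B}(u_I,w)$; 3. ${\rm P}_I^J$ is indecomposable if and only if $I=J$. -/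

import Mathlib

namespace ZeroHecke

open CoxeterSystem

variable {B W : Type*} [Group W] {M : CoxeterMatrix B} (cs : CoxeterSystem M W)

/-! ### Reflections and lengths: what is needed for the braid relations below -/

section Inversions

open Classical in
/-- The signed action of a simple reflection on `W × ℤ/2`. -/
noncomputable def signStep (i : B) : Function.End (W × ZMod 2) := fun p =>
  (cs.simple i * p.1 * cs.simple i, p.2 + if p.1 = cs.simple i then 1 else 0)

theorem semiconj_pow (i j : B) (n : ℕ) :
    cs.simple j * (cs.simple i * cs.simple j) ^ n
      = ((cs.simple i * cs.simple j) ^ n)⁻¹ * cs.simple j := by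
  have h : SemiconjBy (cs.simple j) (cs.simple i * cs.simple j)
      (cs.simple i * cs.simple j)⁻¹ := by
    simp [SemiconjBy, mul_assoc]
  have := (h.pow_right n).eq
  rw [this, inv_pow]

open Classical in
theorem signStep_pow (i j : B) (p : ℕ) (t : W) (e : ZMod 2) :
    ((signStep cs i * signStep cs j) ^ p) (t, e) =
      ((cs.simple i * cs.simple j) ^ p * t * ((cs.simple i * cs.simple j) ^ p)⁻¹,
        e + ∑ n ∈ Finset.range (2 * p),
          if t = cs.simple j * (cs.simple i * cs.simple j) ^ n then 1 else 0) := by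
  induction p with
  | zero => simp; rfl
  | succ p ih =>
    rw [pow_succ']
    change signStep cs i (signStep cs j (((signStep cs i * signStep cs j) ^ p) (t, e))) = _
    rw [ih]
    set c := cs.simple i * cs.simple j with hc
    have h1 : (c ^ p * t * (c ^ p)⁻¹ = cs.simple j) ↔ t = cs.simple j * c ^ (2 * p) := by
      rw [two_mul, pow_add, ← mul_assoc, semiconj_pow, ← hc]
      constructor
      · intro h; rw [← h]; group
      · intro h; rw [h]; group
    have h2 : (cs.simple j * (c ^ p * t * (c ^ p)⁻¹) * cs.simple j = cs.simple i) ↔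
        t = cs.simple j * c ^ (2 * p + 1) := by
      have e1 : cs.simple j * c ^ (2 * p + 1) = (c ^ p)⁻¹ * (cs.simple j * c) * c ^ p := by
        rw [show 2 * p + 1 = p + (1 + p) by ring, pow_add, ← mul_assoc, semiconj_pow, ← hc,
          pow_add, pow_one]
        group
      have e2 : cs.simple j * c = cs.simple j * cs.simple i * cs.simple j := by
        rw [hc]; group
      rw [e1, e2]
      constructor
      · intro h
        rw [← h]
        have : ∀ x : W, cs.simple j * (cs.simple j * x * cs.simple j) * cs.simple j = x := by
          intro x; simp [mul_assoc]
        rw [this]; group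
      · intro h
        have e3 : c ^ p * t * (c ^ p)⁻¹ = cs.simple j * cs.simple i * cs.simple j := by
          rw [h]; group
        rw [e3]
        simp [mul_assoc]
    simp only [signStep]
    rw [show 2 * (p + 1) = 2 * p + 1 + 1 by ring, Finset.sum_range_succ, Finset.sum_range_succ]
    refine Prod.ext ?_ ?_
    · simp only [pow_succ' c p]
      rw [mul_inv_rev, hc, mul_inv_rev, cs.inv_simple, cs.inv_simple]
      simp only [mul_assoc]
    · simp only [h1, h2]
      simp only [add_assoc]

theorem signStep_liftable : M.IsLiftable (signStep cs) := by
  classical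
  intro i j
  funext ⟨t, e⟩
  rw [signStep_pow, cs.simple_mul_simple_pow]
  have : ∑ n ∈ Finset.range (2 * M i j),
      (if t = cs.simple j * (cs.simple i * cs.simple j) ^ n then (1 : ZMod 2) else 0) = 0 := by
    rw [two_mul, Finset.sum_range_add]
    simp only [pow_add, cs.simple_mul_simple_pow, one_mul]
    exact CharTwo.add_self_eq_zero _
  rw [this]
  simp
  rfl

/-- The signed permutation action of `W` on `W × ℤ/2`. -/
noncomputable def signHom : W →* Function.End (W × ZMod 2) :=
  cs.lift ⟨signStep cs, signStep_liftable cs⟩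

/-- `eta w t` is the parity of the number of times that `t` occurs in the right inversion sequence
of a word for `w`. -/
noncomputable def eta (w t : W) : ZMod 2 := (signHom cs w (t, 0)).2

theorem signHom_simple (i : B) : signHom cs (cs.simple i) = signStep cs i :=
  cs.lift_apply_simple (signStep_liftable cs) i

theorem signHom_apply (w t : W) (e : ZMod 2) :
    signHom cs w (t, e) = (w * t * w⁻¹, e + eta cs w t) := by
  have key : ∀ w : W, ∃ f : W → ZMod 2, ∀ t e, signHom cs w (t, e) = (w * t * w⁻¹, e + f t) := by
    intro w
    induction w using cs.simple_induction_left with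
    | one => exact ⟨fun _ => 0, fun t e => by rw [map_one]; simp; rfl⟩
    | mul_simple_left w i ih =>
      obtain ⟨f, hf⟩ := ih
      classical
      refine ⟨fun t => f t + if w * t * w⁻¹ = cs.simple i then 1 else 0, fun t e => ?_⟩
      rw [map_mul]
      change signHom cs (cs.simple i) (signHom cs w (t, e)) = _
      rw [hf, signHom_simple]
      simp only [signStep, mul_inv_rev, cs.inv_simple, mul_assoc, add_assoc]
  obtain ⟨f, hf⟩ := key w
  have : eta cs w t = f t := by simp [eta, hf]
  rw [this, hf]

theorem eta_mul (u v t : W) :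
    eta cs (u * v) t = eta cs v t + eta cs u (v * t * v⁻¹) := by
  have : signHom cs (u * v) (t, 0) = signHom cs u (signHom cs v (t, 0)) := by
    rw [map_mul]; rfl
  rw [signHom_apply, signHom_apply, signHom_apply] at this
  simpa using congrArg Prod.snd this

open Classical in
theorem eta_simple (i : B) (t : W) :
    eta cs (cs.simple i) t = if t = cs.simple i then 1 else 0 := by
  simp [eta, signHom_simple, signStep]

theorem eta_one (t : W) : eta cs 1 t = 0 := by
  have := eta_mul cs 1 1 t
  simpa using this

theorem eta_wordProd_eq_zero (ω : List B) (t : W) (h : t ∉ cs.rightInvSeq ω) :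
    eta cs (cs.wordProd ω) t = 0 := by
  classical
  induction ω with
  | nil => simpa using eta_one cs t
  | cons i ω ih =>
    simp only [rightInvSeq, List.mem_cons, not_or] at h
    rw [cs.wordProd_cons, eta_mul, ih h.2, eta_simple, if_neg, add_zero]
    intro h'
    apply h.1
    rw [← h']; group

theorem length_lt_of_eta {w t : W} (h : eta cs w t ≠ 0) :
    cs.length (w * t) < cs.length w := by
  obtain ⟨ω, hω, rfl⟩ := cs.exists_isReduced w
  have : t ∈ cs.rightInvSeq ω := by
    by_contra h'
    exact h (eta_wordProd_eq_zero cs ω t h')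
  exact (cs.isRightInversion_of_mem_rightInvSeq hω this).2

theorem eta_conj_simple (g : W) (i : B) :
    eta cs (g⁻¹ * cs.simple i * g) (g⁻¹ * cs.simple i * g) = 1 := by
  classical
  have h0 := eta_mul cs g⁻¹ g (g⁻¹ * cs.simple i * g)
  rw [inv_mul_cancel, eta_one] at h0
  have e1 : g * (g⁻¹ * cs.simple i * g) * g⁻¹ = cs.simple i := by group
  rw [e1] at h0
  have h1 := eta_mul cs (g⁻¹ * cs.simple i) g (g⁻¹ * cs.simple i * g)
  have h2 := eta_mul cs g⁻¹ (cs.simple i) (cs.simple i)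
  rw [e1] at h1
  rw [eta_simple, if_pos rfl] at h2
  simp only [cs.inv_simple, mul_assoc, cs.simple_mul_simple_self, one_mul] at h1 h2 h0 ⊢
  rw [h1, h2, add_left_comm, ← h0, add_zero]

/-- A simple reflection `s` is a left descent of `g` if and only if `g⁻¹ s g` occurs an odd number
of times in the inversion sequences of `g`. -/
theorem isLeftDescent_iff_eta (g : W) (i : B) :
    cs.IsLeftDescent g i ↔ eta cs g (g⁻¹ * cs.simple i * g) ≠ 0 := by
  have e1 : g * (g⁻¹ * cs.simple i * g) = cs.simple i * g := by group
  constructor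
  · intro h h0
    have h1 := eta_mul cs g (g⁻¹ * cs.simple i * g) (g⁻¹ * cs.simple i * g)
    rw [eta_conj_simple, mul_inv_cancel_right, h0, e1, add_zero] at h1
    have h2 := length_lt_of_eta cs (w := cs.simple i * g) (t := g⁻¹ * cs.simple i * g)
      (by rw [h1]; exact one_ne_zero)
    have e2 : cs.simple i * g * (g⁻¹ * cs.simple i * g) = g := by
      simp [mul_assoc]
    rw [e2] at h2
    exact absurd h (by unfold IsLeftDescent; omega)
  · intro h
    have := length_lt_of_eta cs h
    rwa [e1] at this

/-- If `y` has minimal length in its coset `⟨s_i, s_j⟩ y`, then left descents of `x y`, for `x` in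
the subgroup, are those of `x`. -/
theorem eta_min {D : Subgroup W} {y : W} (hy : ∀ x ∈ D, cs.length y ≤ cs.length (x * y))
    {x : W} (hx : x ∈ D) {i : B} (hi : cs.simple i ∈ D) :
    cs.IsLeftDescent (x * y) i ↔ eta cs x (x⁻¹ * cs.simple i * x) ≠ 0 := by
  rw [isLeftDescent_iff_eta, eta_mul]
  have h0 : eta cs y ((x * y)⁻¹ * cs.simple i * (x * y)) = 0 := by
    by_contra h
    have h1 := length_lt_of_eta cs h
    have e : y * ((x * y)⁻¹ * cs.simple i * (x * y)) = (x⁻¹ * cs.simple i * x) * y := by group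
    rw [e] at h1
    have := hy _ (D.mul_mem (D.mul_mem (D.inv_mem hx) hi) hx)
    omega
  have e : y * ((x * y)⁻¹ * cs.simple i * (x * y)) * y⁻¹ = x⁻¹ * cs.simple i * x := by group
  rw [h0, e, zero_add]

end Inversions

/-! ### The operators on the group -/

section Operators

open Classical in
/-- The operator on `W` that sends `w` to `w` if `s_i` is a left descent of `w`, and to `s_i w`
otherwise. -/
noncomputable def step (i : B) (w : W) : W :=
  if cs.IsLeftDescent w i then w else cs.simple i * w

/-- The composite of the operators of a word, the last letter acting first. -/
noncomputable def act : List B → W → W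
  | [], w => w
  | i :: ω, w => step cs i (act ω w)

/-- The product of the alternating word of length `k` in `i`, `j` that ends in `i`. -/
noncomputable def alt (i j : B) (k : ℕ) : W := cs.wordProd (alternatingWord j i k)

theorem alt_zero (i j : B) : alt cs i j 0 = 1 := by simp [alt, alternatingWord]

theorem alt_succ (i j : B) (k : ℕ) :
    alt cs i j (k + 1) = cs.simple (if Even k then i else j) * alt cs i j k := by
  rw [alt, alternatingWord_succ', cs.wordProd_cons, alt]

theorem alt_even (i j : B) (q : ℕ) : alt cs i j (2 * q) = (cs.simple j * cs.simple i) ^ q := by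
  rw [alt, prod_alternatingWord_eq_mul_pow]
  simp

theorem alt_odd (i j : B) (q : ℕ) :
    alt cs i j (2 * q + 1) = cs.simple i * (cs.simple j * cs.simple i) ^ q := by
  rw [alt, prod_alternatingWord_eq_mul_pow]
  have : (2 * q + 1) / 2 = q := by omega
  simp [this]

theorem alt_succ_right (i j : B) (k : ℕ) :
    alt cs i j (k + 1) = alt cs i j k * (cs.simple i * (cs.simple j * cs.simple i) ^ k) := by
  have key : ∀ q : ℕ, ∀ x : W, cs.simple i * ((cs.simple j * cs.simple i) ^ q * x)
      = ((cs.simple j * cs.simple i) ^ q)⁻¹ * (cs.simple i * x) := by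
    intro q x
    rw [← mul_assoc, semiconj_pow, mul_assoc]
  rcases Nat.even_or_odd' k with ⟨q, rfl | rfl⟩
  · rw [alt_odd, alt_even, two_mul, pow_add, key q (_ ^ q), mul_inv_cancel_left]
  · rw [show 2 * q + 1 + 1 = 2 * (q + 1) by ring, alt_even, alt_odd,
      show 2 * q + 1 = q + (q + 1) by ring, pow_add _ q (q + 1), key, mul_assoc,
      mul_inv_cancel_left, cs.simple_mul_simple_cancel_left]

theorem alt_conj (i j : B) (k : ℕ) :
    (alt cs i j k)⁻¹ * cs.simple (if Even k then i else j) * alt cs i j k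
      = cs.simple i * (cs.simple j * cs.simple i) ^ k := by
  rw [mul_assoc, ← alt_succ, alt_succ_right, inv_mul_cancel_left]

theorem eta_alt (i j : B) (t : W) (k : ℕ)
    (h : ∀ n < k, t ≠ cs.simple i * (cs.simple j * cs.simple i) ^ n) :
    eta cs (alt cs i j k) t = 0 := by
  classical
  induction k with
  | zero => rw [alt_zero, eta_one]
  | succ k ih =>
    rw [alt_succ, eta_mul, ih (fun n hn => h n (by omega)), eta_simple, if_neg, add_zero]
    intro h'
    apply h k (by omega)
    rw [← alt_conj, ← h']
    group

theorem alt_mem {D : Subgroup W} {i j : B} (hi : cs.simple i ∈ D) (hj : cs.simple j ∈ D) (k : ℕ) :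
    alt cs i j k ∈ D := by
  induction k with
  | zero => rw [alt_zero]; exact D.one_mem
  | succ k ih =>
    rw [alt_succ]
    refine D.mul_mem ?_ ih
    split_ifs <;> assumption

variable {D : Subgroup W} {y : W} {i j : B}

theorem not_isLeftDescent_alt (hy : ∀ x ∈ D, cs.length y ≤ cs.length (x * y))
    (hi : cs.simple i ∈ D) (hj : cs.simple j ∈ D) {k : ℕ}
    (hk : k < orderOf (cs.simple j * cs.simple i)) :
    ¬ cs.IsLeftDescent (alt cs i j k * y) (if Even k then i else j) := by
  have hm : cs.simple (if Even k then i else j) ∈ D := by split_ifs <;> assumption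
  rw [eta_min cs hy (alt_mem cs hi hj k) hm, alt_conj, not_not]
  apply eta_alt
  intro n hn h
  have h1 := mul_left_cancel h
  have := pow_injOn_Iio_orderOf (Set.mem_Iio.mpr hk) (Set.mem_Iio.mpr (hn.trans hk)) h1
  omega

theorem step_alt (hy : ∀ x ∈ D, cs.length y ≤ cs.length (x * y))
    (hi : cs.simple i ∈ D) (hj : cs.simple j ∈ D) {k : ℕ}
    (hk : k < orderOf (cs.simple j * cs.simple i)) :
    step cs (if Even k then i else j) (alt cs i j k * y) = alt cs i j (k + 1) * y := by
  rw [step, if_neg (not_isLeftDescent_alt cs hy hi hj hk), alt_succ, mul_assoc]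

theorem step_alt_stay (hy : ∀ x ∈ D, cs.length y ≤ cs.length (x * y))
    (hi : cs.simple i ∈ D) (hj : cs.simple j ∈ D) {k : ℕ}
    (hk : k < orderOf (cs.simple j * cs.simple i)) :
    step cs (if Even k then i else j) (alt cs i j (k + 1) * y) = alt cs i j (k + 1) * y := by
  rw [step, if_pos]
  have h := not_isLeftDescent_alt cs hy hi hj hk
  rw [alt_succ, mul_assoc]
  unfold IsLeftDescent at h ⊢
  rw [cs.simple_mul_simple_cancel_left]
  have := cs.length_simple_mul_ne (alt cs i j k * y) (if Even k then i else j)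
  omega

theorem alt_orderOf (i j : B) :
    alt cs i j (orderOf (cs.simple j * cs.simple i))
      = alt cs j i (orderOf (cs.simple j * cs.simple i)) := by
  have hc := pow_orderOf_eq_one (cs.simple j * cs.simple i)
  generalize orderOf (cs.simple j * cs.simple i) = d at hc ⊢
  have hinv : cs.simple i * cs.simple j = (cs.simple j * cs.simple i)⁻¹ := by simp
  rcases Nat.even_or_odd' d with ⟨q, rfl | rfl⟩
  · rw [alt_even, alt_even, hinv, inv_pow, ← mul_eq_one_iff_eq_inv, ← pow_add, ← two_mul, hc]
  · rw [alt_odd, alt_odd, hinv, inv_pow]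
    have h1 : (cs.simple j * cs.simple i) ^ (q + 1) = ((cs.simple j * cs.simple i) ^ q)⁻¹ := by
      rw [← mul_eq_one_iff_eq_inv, ← pow_add, ← hc]
      congr 1; ring
    rw [← h1, pow_succ', mul_assoc, cs.simple_mul_simple_cancel_left]

theorem orderOf_swap (i j : B) :
    orderOf (cs.simple i * cs.simple j) = orderOf (cs.simple j * cs.simple i) := by
  rw [← orderOf_inv]; simp

/-- Both generators are left descents of the top of a coset. -/
theorem step_top (hy : ∀ x ∈ D, cs.length y ≤ cs.length (x * y))
    (hi : cs.simple i ∈ D) (hj : cs.simple j ∈ D)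
    (hd : 0 < orderOf (cs.simple j * cs.simple i)) {l : B} (hl : l = i ∨ l = j) :
    step cs l (alt cs i j (orderOf (cs.simple j * cs.simple i)) * y)
      = alt cs i j (orderOf (cs.simple j * cs.simple i)) * y := by
  have h2 := alt_orderOf cs i j
  have h3 := orderOf_swap cs i j
  obtain ⟨d, hd'⟩ : ∃ d, orderOf (cs.simple j * cs.simple i) = d + 1 := ⟨_, (Nat.sub_add_cancel hd).symm⟩
  have h0 := step_alt_stay cs hy hi hj (k := d) (by omega)
  have h1 := step_alt_stay cs hy hj hi (k := d) (by omega)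
  rw [hd'] at h2 ⊢
  rcases Nat.even_or_odd d with he | ho
  · rw [if_pos he] at h0 h1
    rcases hl with rfl | rfl
    · exact h0
    · rw [h2]; exact h1
  · rw [if_neg (Nat.not_even_iff_odd.mpr ho)] at h0 h1
    rcases hl with rfl | rfl
    · rw [h2]; exact h1
    · exact h0

/-- Alternating operators climb a coset to its top. -/
theorem act_climb (hy : ∀ x ∈ D, cs.length y ≤ cs.length (x * y))
    (hi : cs.simple i ∈ D) (hj : cs.simple j ∈ D)
    (hd : 0 < orderOf (cs.simple j * cs.simple i)) {p q : B}
    (hpq : (p = j ∧ q = i) ∨ (p = i ∧ q = j)) (x : W) (n₀ : ℕ)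
    (h₀ : ∃ k ≤ orderOf (cs.simple j * cs.simple i), min n₀ (orderOf (cs.simple j * cs.simple i)) ≤ k ∧
      act cs (alternatingWord p q n₀) x = alt cs i j k * y ∧
        (k < orderOf (cs.simple j * cs.simple i) →
          (if Even n₀ then q else p) = (if Even k then i else j)))
    (n : ℕ) (hn : n₀ ≤ n) :
    ∃ k ≤ orderOf (cs.simple j * cs.simple i), min n (orderOf (cs.simple j * cs.simple i)) ≤ k ∧
      act cs (alternatingWord p q n) x = alt cs i j k * y ∧
        (k < orderOf (cs.simple j * cs.simple i) →
          (if Even n then q else p) = (if Even k then i else j)) := by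
  induction n, hn using Nat.le_induction with
  | base => exact h₀
  | succ n hn ih =>
    obtain ⟨k, hk, hmin, hx, hc⟩ := ih
    rw [alternatingWord_succ', act, hx]
    rcases hk.lt_or_eq with hlt | rfl
    · rw [hc hlt, step_alt cs hy hi hj hlt]
      refine ⟨k + 1, hlt, by omega, rfl, fun _ => ?_⟩
      have := hc hlt
      by_cases h1 : Even n <;> by_cases h2 : Even k <;>
        simp only [h1, h2, if_true, if_false, Nat.even_add_one, not_true, not_false_iff] at this ⊢ <;>
        rcases hpq with ⟨rfl, rfl⟩ | ⟨rfl, rfl⟩ <;> simp_all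
    · refine ⟨_, le_rfl, by omega, ?_, fun h => absurd h (lt_irrefl _)⟩
      apply step_top cs hy hi hj hd
      rcases hpq with ⟨rfl, rfl⟩ | ⟨rfl, rfl⟩ <;> split_ifs <;> simp

theorem act_alt_eq_top (hy : ∀ x ∈ D, cs.length y ≤ cs.length (x * y))
    (hi : cs.simple i ∈ D) (hj : cs.simple j ∈ D)
    (hd : 0 < orderOf (cs.simple j * cs.simple i)) {m : ℕ}
    (hm : orderOf (cs.simple j * cs.simple i) ≤ m) {k : ℕ}
    (hk : k ≤ orderOf (cs.simple j * cs.simple i)) {p q : B}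
    (hpq : (p = j ∧ q = i) ∨ (p = i ∧ q = j)) :
    act cs (alternatingWord p q m) (alt cs i j k * y)
      = alt cs i j (orderOf (cs.simple j * cs.simple i)) * y := by
  have fin : ∀ {i j p q : B} (hi : cs.simple i ∈ D) (hj : cs.simple j ∈ D)
      (hd : 0 < orderOf (cs.simple j * cs.simple i))
      (hm : orderOf (cs.simple j * cs.simple i) ≤ m)
      (hpq : (p = j ∧ q = i) ∨ (p = i ∧ q = j)) (x : W) (n₀ : ℕ) (_ : n₀ ≤ 1),
      (∃ k ≤ orderOf (cs.simple j * cs.simple i),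
        min n₀ (orderOf (cs.simple j * cs.simple i)) ≤ k ∧
        act cs (alternatingWord p q n₀) x = alt cs i j k * y ∧
          (k < orderOf (cs.simple j * cs.simple i) →
            (if Even n₀ then q else p) = (if Even k then i else j))) →
      act cs (alternatingWord p q m) x
        = alt cs i j (orderOf (cs.simple j * cs.simple i)) * y := by
    intro i j p q hi hj hd hm hpq x n₀ hn₀ h
    obtain ⟨k, h1, h2, h3, -⟩ := act_climb cs hy hi hj hd hpq x n₀ h m (by omega)
    rw [min_eq_right hm] at h2
    rw [h3, le_antisymm h1 h2]
  by_cases hq : q = if Even k then i else j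
  · exact fin hi hj hd hm hpq _ 0 (by omega)
      ⟨k, hk, by omega, by simp [alternatingWord, act], fun _ => by simpa using hq⟩
  · rcases Nat.eq_zero_or_pos k with rfl | hkpos
    · have h2 := alt_orderOf cs i j
      have h3 := orderOf_swap cs i j
      have hq' : q = j ∧ p = i := by
        rcases hpq with ⟨rfl, rfl⟩ | ⟨rfl, rfl⟩
        · simp at hq
        · exact ⟨rfl, rfl⟩
      rw [h2, ← h3]
      obtain ⟨rfl, rfl⟩ := hq'
      refine fin hj hi (by omega) (by omega) (Or.inl ⟨rfl, rfl⟩) _ 0 (by omega)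
        ⟨0, by omega, by omega, ?_, fun _ => by simp⟩
      simp [alternatingWord, act, alt_zero]
    · obtain ⟨k, rfl⟩ : ∃ k', k = k' + 1 := ⟨k - 1, by omega⟩
      have hq2 : q = if Even k then i else j := by
        rcases hpq with ⟨rfl, rfl⟩ | ⟨rfl, rfl⟩ <;> by_cases h2 : Even k <;>
          simp_all [Nat.even_add_one]
      have hp2 : p = if Even (k + 1) then i else j := by
        clear fin hy
        simp only [Nat.even_add_one]
        grind
      refine fin hi hj hd hm hpq _ 1 le_rfl ⟨k + 1, hk, by omega, ?_, fun _ => by simpa using hp2⟩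
      have : alternatingWord p q 1 = [q] := by simp [alternatingWord]
      rw [this, act, act, hq2]
      exact step_alt_stay cs hy hi hj (by omega)

/-- The operators on `W` satisfy the braid relations. -/
theorem act_braid (i j : B) (w : W) :
    act cs (alternatingWord i j (M i j)) w = act cs (alternatingWord j i (M i j)) w := by
  rcases Nat.eq_zero_or_pos (M i j) with h0 | hpos
  · rw [h0]; rfl
  set D : Subgroup W := Subgroup.closure {cs.simple i, cs.simple j} with hD
  have hi : cs.simple i ∈ D := Subgroup.subset_closure (by simp)
  have hj : cs.simple j ∈ D := Subgroup.subset_closure (by simp)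
  have hpow : (cs.simple j * cs.simple i) ^ M i j = 1 := by
    rw [← M.symmetric]; exact cs.simple_mul_simple_pow j i
  have hd : 0 < orderOf (cs.simple j * cs.simple i) :=
    orderOf_pos_iff.mpr (isOfFinOrder_iff_pow_eq_one.mpr ⟨_, hpos, hpow⟩)
  have hm : orderOf (cs.simple j * cs.simple i) ≤ M i j := orderOf_le_of_pow_eq_one hpos hpow
  obtain ⟨x₀, hx₀, hmin⟩ : ∃ x₀ ∈ D, ∀ x ∈ D, cs.length (x₀ * w) ≤ cs.length (x * w) := by
    have := (measure fun x : W => cs.length (x * w)).wf.has_min (D : Set W) ⟨1, D.one_mem⟩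
    obtain ⟨x₀, h1, h2⟩ := this
    exact ⟨x₀, h1, fun x hx => not_lt.mp (h2 x hx)⟩
  set y := x₀ * w with hy'
  have hy : ∀ x ∈ D, cs.length y ≤ cs.length (x * y) := fun x hx => by
    rw [hy', ← mul_assoc]; exact hmin _ (D.mul_mem hx hx₀)
  have h2 := alt_orderOf cs i j
  have h3 := orderOf_swap cs i j
  have hcover : ∀ x ∈ D, ∃ k ≤ orderOf (cs.simple j * cs.simple i),
      x = alt cs i j k ∨ x = alt cs j i k := by
    have main : ∀ l, l = i ∨ l = j → ∀ x : W, (∃ k ≤ orderOf (cs.simple j * cs.simple i),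
        x = alt cs i j k ∨ x = alt cs j i k) → ∃ k ≤ orderOf (cs.simple j * cs.simple i),
        cs.simple l * x = alt cs i j k ∨ cs.simple l * x = alt cs j i k := by
      have aux : ∀ i j : B, 0 < orderOf (cs.simple j * cs.simple i) → ∀ l, l = i ∨ l = j →
          ∀ k ≤ orderOf (cs.simple j * cs.simple i),
          ∃ k' ≤ orderOf (cs.simple j * cs.simple i),
          cs.simple l * alt cs i j k = alt cs i j k' ∨
            cs.simple l * alt cs i j k = alt cs j i k' := by
        intro i j hd l hl k hk
        have hcancel : ∀ k', k = k' + 1 → (if Even k' then i else j) = l →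
            cs.simple l * alt cs i j k = alt cs i j k' := by
          rintro k' rfl rfl
          rw [alt_succ, cs.simple_mul_simple_cancel_left]
        by_cases hlk : (if Even k then i else j) = l
        · rcases hk.lt_or_eq with hlt | rfl
          · exact ⟨k + 1, hlt, Or.inl (by rw [alt_succ, hlk])⟩
          · obtain ⟨d, hd'⟩ : ∃ d, orderOf (cs.simple j * cs.simple i) = d + 1 :=
              ⟨_, (Nat.sub_add_cancel hd).symm⟩
            refine ⟨d, by omega, Or.inr ?_⟩
            rw [alt_orderOf, hd', alt_succ]
            have : (if Even d then j else i) = l := by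
              rw [← hlk, hd']
              by_cases he : Even d <;> simp [he, Nat.even_add_one]
            rw [this, cs.simple_mul_simple_cancel_left]
        · rcases Nat.eq_zero_or_pos k with rfl | hkpos
          · refine ⟨1, hd, Or.inr ?_⟩
            have : l = j := by
              rcases hl with rfl | rfl
              · simp at hlk
              · rfl
            subst this
            simp [alt_zero, alt_succ]
          · refine ⟨k - 1, by omega, Or.inl (hcancel (k - 1) (by omega) ?_)⟩
            obtain ⟨k', rfl⟩ : ∃ k', k = k' + 1 := ⟨k - 1, by omega⟩
            rw [Nat.add_sub_cancel]
            by_cases he : Even k' <;> rcases hl with rfl | rfl <;>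
              simp_all [Nat.even_add_one]
      rintro l hl x ⟨k, hk, rfl | rfl⟩
      · exact aux i j hd l hl k hk
      · obtain ⟨k', hk', h⟩ := aux j i (by omega) l hl.symm k (by omega)
        exact ⟨k', by omega, h.symm⟩
    intro x hx
    induction hx using Subgroup.closure_induction_left with
    | one => exact ⟨0, by omega, Or.inl (alt_zero cs i j).symm⟩
    | mul_left a ha b hb ih =>
      rcases ha with rfl | rfl
      · exact main i (Or.inl rfl) b ih
      · exact main j (Or.inr rfl) b ih
    | inv_mul_cancel a ha b hb ih =>
      rcases ha with rfl | rfl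
      · rw [cs.inv_simple]; exact main i (Or.inl rfl) b ih
      · rw [cs.inv_simple]; exact main j (Or.inr rfl) b ih
  obtain ⟨k, hk, hx⟩ := hcover x₀⁻¹ (D.inv_mem hx₀)
  have hw : w = x₀⁻¹ * y := by rw [hy', inv_mul_cancel_left]
  rw [hw]
  rcases hx with hx | hx
  · rw [hx, act_alt_eq_top cs hy hi hj hd hm hk (Or.inr ⟨rfl, rfl⟩),
      act_alt_eq_top cs hy hi hj hd hm hk (Or.inl ⟨rfl, rfl⟩)]
  · rw [hx, act_alt_eq_top cs hy hj hi (by omega) (by omega) (by omega) (Or.inl ⟨rfl, rfl⟩),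
      act_alt_eq_top cs hy hj hi (by omega) (by omega) (by omega) (Or.inr ⟨rfl, rfl⟩)]

end Operators

/-! ### The `0`-Hecke algebra -/

section Algebra

variable (K : Type*) [Field K] (M)

/-- The defining relations `π_i ^ 2 = π_i` and `π_i π_j ⋯ = π_j π_i ⋯` (with `M i j` factors on
each side). -/
inductive HeckeRel : FreeAlgebra K B → FreeAlgebra K B → Prop
  | idem (i : B) : HeckeRel (FreeAlgebra.ι K i * FreeAlgebra.ι K i) (FreeAlgebra.ι K i)
  | braid (i j : B) (h : i ≠ j) :
      HeckeRel ((alternatingWord i j (M i j)).map (FreeAlgebra.ι K)).prod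
        ((alternatingWord j i (M i j)).map (FreeAlgebra.ι K)).prod

/-- The `0`-Hecke algebra over `K` of a Coxeter matrix, by generators and relations. -/
abbrev HeckeAlgebra : Type _ := RingQuot (HeckeRel M K)

/-- The generator `π_i` of the `0`-Hecke algebra. -/
noncomputable def HeckeAlgebra.gen (i : B) : HeckeAlgebra M K :=
  RingQuot.mkAlgHom K (HeckeRel M K) (FreeAlgebra.ι K i)

end Algebra

/-! ### Left weak Bruhat order, descent classes -/

section Order

/-- The left weak Bruhat order. -/
def LeftWeakLE (u v : W) : Prop :=
  ∃ ω : List B, v = cs.wordProd ω * u ∧ cs.length v = cs.length u + ω.length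

/-- The left weak Bruhat interval `[u, v]_L`. -/
def leftInterval (u v : W) : Set W := {w | LeftWeakLE cs u w ∧ LeftWeakLE cs w v}

/-- The right descent set of `w`, as a set of indices of simple reflections. -/
def rightDescentSet (w : W) : Set B := {i | cs.IsRightDescent w i}

/-- The right descent class of `I`. -/
def descentClass (I : Set B) : Set W := {w | rightDescentSet cs w = I}

/-- The shortest element `u_I` of the right descent class of `I`. (In a finite Coxeter group, each
right descent class has exactly one element of minimal length.) -/
noncomputable def shortestElt (I : Set B) : W :=
  Classical.epsilon fun u => u ∈ descentClass cs I ∧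
    ∀ w ∈ descentClass cs I, cs.length u ≤ cs.length w

/-- The longest element `v_I` of the right descent class of `I`. (In a finite Coxeter group, each
right descent class has exactly one element of maximal length.) -/
noncomputable def longestElt (I : Set B) : W :=
  Classical.epsilon fun v => v ∈ descentClass cs I ∧
    ∀ w ∈ descentClass cs I, cs.length w ≤ cs.length v

theorem LeftWeakLE.trans {u v w : W} (h₁ : LeftWeakLE cs u v) (h₂ : LeftWeakLE cs v w) :
    LeftWeakLE cs u w := by
  obtain ⟨ω₁, rfl, h₁⟩ := h₁
  obtain ⟨ω₂, rfl, h₂⟩ := h₂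
  refine ⟨ω₂ ++ ω₁, by rw [cs.wordProd_append, mul_assoc], ?_⟩
  rw [h₂, h₁, List.length_append]
  omega

theorem LeftWeakLE.step (i : B) (w : W) : LeftWeakLE cs w (step cs i w) := by
  rw [ZeroHecke.step]
  split_ifs with h
  · exact ⟨[], by simp⟩
  · exact ⟨[i], by simp, by simpa using (cs.not_isLeftDescent_iff).mp h⟩

theorem LeftWeakLE.act (ω : List B) (w : W) : LeftWeakLE cs w (act cs ω w) := by
  induction ω with
  | nil => exact ⟨[], by simp [ZeroHecke.act]⟩
  | cons i ω ih => exact ih.trans cs (LeftWeakLE.step cs i _)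

end Order

/-! ### Weak Bruhat interval modules -/

section Modules

variable (K : Type*) [Field K]

/-- The underlying space `K[u, v]_L` of the weak Bruhat interval module `B(u, v)`. -/
def IntervalModule (u v : W) : Type _ := leftInterval cs u v →₀ K

noncomputable instance (u v : W) : AddCommGroup (IntervalModule cs K u v) :=
  inferInstanceAs (AddCommGroup (leftInterval cs u v →₀ K))

noncomputable instance (u v : W) : Module K (IntervalModule cs K u v) :=
  inferInstanceAs (Module K (leftInterval cs u v →₀ K))

/-- The basis vector of `B(u, v)` given by an element of `[u, v]_L`. -/
noncomputable def IntervalModule.of {u v : W} (w : leftInterval cs u v) : IntervalModule cs K u v :=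
  Finsupp.single w 1

/-- The elements of `[u, v]_L` as a `K`-basis of `B(u, v)`. -/
noncomputable def IntervalModule.basis (u v : W) :
    Module.Basis (leftInterval cs u v) K (IntervalModule cs K u v) :=
  ⟨LinearEquiv.refl K (leftInterval cs u v →₀ K)⟩

theorem IntervalModule.basis_apply {u v : W} (w : leftInterval cs u v) :
    IntervalModule.basis cs K u v w = IntervalModule.of cs K w := rfl

open Classical in
/-- The operator by which `π_i` acts on `B(u, v)`. -/
noncomputable def intervalOp (u v : W) (i : B) : Module.End K (IntervalModule cs K u v) :=
  (IntervalModule.basis cs K u v).constr K fun w =>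
    if cs.IsLeftDescent w.1 i then IntervalModule.of cs K w
    else if h : cs.simple i * w.1 ∈ leftInterval cs u v then
      IntervalModule.of cs K ⟨cs.simple i * w.1, h⟩
    else 0

open Classical in
theorem intervalOp_of (u v : W) (i : B) (w : leftInterval cs u v) :
    intervalOp cs K u v i (IntervalModule.of cs K w) =
      if h : step cs i w.1 ∈ leftInterval cs u v then IntervalModule.of cs K ⟨step cs i w.1, h⟩
      else 0 := by
  rw [← IntervalModule.basis_apply, intervalOp, Module.Basis.constr_basis]
  by_cases h : cs.IsLeftDescent w.1 i
  · have hs : step cs i w.1 = w.1 := by rw [step, if_pos h]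
    simp [h, hs]
  · have hs : step cs i w.1 = cs.simple i * w.1 := by rw [step, if_neg h]
    simp [h, hs]

open Classical in
theorem intervalOp_prod (u v : W) (ω : List B) (w : leftInterval cs u v) :
    (ω.map (intervalOp cs K u v)).prod (IntervalModule.of cs K w) =
      if h : act cs ω w.1 ∈ leftInterval cs u v then IntervalModule.of cs K ⟨act cs ω w.1, h⟩
      else 0 := by
  induction ω with
  | nil => simp [act]
  | cons i ω ih =>
    rw [List.map_cons, List.prod_cons, Module.End.mul_apply, ih]
    by_cases h : act cs ω w.1 ∈ leftInterval cs u v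
    · rw [dif_pos h, intervalOp_of]
      rfl
    · rw [dif_neg h, map_zero, dif_neg]
      intro h'
      exact h ⟨w.2.1.trans cs (LeftWeakLE.act cs ω _),
        (LeftWeakLE.step cs i (act cs ω w.1)).trans cs h'.2⟩

theorem step_step (i : B) (w : W) : step cs i (step cs i w) = step cs i w := by
  by_cases h : cs.IsLeftDescent w i
  · have hs : step cs i w = w := by rw [step, if_pos h]
    rw [hs, hs]
  · have hs : step cs i w = cs.simple i * w := by rw [step, if_neg h]
    rw [hs, step, if_pos]
    by_contra h'
    exact h (cs.isLeftDescent_iff_not_isLeftDescent_mul.mpr h')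

theorem intervalOp_rel (u v : W) ⦃x y : FreeAlgebra K B⦄ (h : HeckeRel M K x y) :
    FreeAlgebra.lift K (intervalOp cs K u v) x = FreeAlgebra.lift K (intervalOp cs K u v) y := by
  classical
  cases h with
  | idem i =>
    apply (IntervalModule.basis cs K u v).ext
    intro w
    have h1 := intervalOp_prod cs K u v [i, i] w
    have h2 := intervalOp_prod cs K u v [i] w
    simp only [act, step_step, List.map_cons, List.map_nil, List.prod_cons, List.prod_nil,
      mul_one] at h1 h2
    rw [map_mul, FreeAlgebra.lift_ι_apply, IntervalModule.basis_apply]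
    exact h1.trans h2.symm
  | braid i j _ =>
    rw [map_list_prod, map_list_prod, List.map_map, List.map_map]
    have e : (FreeAlgebra.lift K (intervalOp cs K u v) : FreeAlgebra K B → _) ∘ FreeAlgebra.ι K
        = intervalOp cs K u v := by
      funext l; simp
    rw [e]
    apply (IntervalModule.basis cs K u v).ext
    intro w
    rw [IntervalModule.basis_apply, intervalOp_prod, intervalOp_prod]
    simp only [act_braid cs i j]

/-- The representation of the `0`-Hecke algebra on `B(u, v)`. -/
noncomputable def intervalRep (u v : W) :
    HeckeAlgebra M K →ₐ[K] Module.End K (IntervalModule cs K u v) :=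
  RingQuot.liftAlgHom K ⟨FreeAlgebra.lift K (intervalOp cs K u v), intervalOp_rel cs K u v⟩

/-- The weak Bruhat interval module `B(u, v)`. -/
noncomputable instance (u v : W) : Module (HeckeAlgebra M K) (IntervalModule cs K u v) :=
  Module.compHom _ (intervalRep cs K u v).toRingHom

open Classical in
/-- The action of the generators on the elements of the interval. -/
theorem gen_smul_of (u v : W) (i : B) (w : leftInterval cs u v) :
    HeckeAlgebra.gen M K i • IntervalModule.of cs K w =
      if cs.IsLeftDescent w.1 i then IntervalModule.of cs K w
      else if h : cs.simple i * w.1 ∈ leftInterval cs u v then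
        IntervalModule.of cs K ⟨cs.simple i * w.1, h⟩
      else 0 := by
  change intervalRep cs K u v (HeckeAlgebra.gen M K i) (IntervalModule.of cs K w) = _
  rw [intervalRep, HeckeAlgebra.gen, RingQuot.liftAlgHom_mkAlgHom_apply, FreeAlgebra.lift_ι_apply,
    ← IntervalModule.basis_apply, intervalOp, Module.Basis.constr_basis]
  rfl

/-- Scalars act on `B(u, v)` as they do on the space `K[u, v]_L`. -/
theorem algebraMap_smul (u v : W) (a : K) (x : IntervalModule cs K u v) :
    algebraMap K (HeckeAlgebra M K) a • x = a • x := by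
  change intervalRep cs K u v (algebraMap K (HeckeAlgebra M K) a) x = _
  rw [AlgHom.commutes]
  rfl

/-- The module `P_I^J = B(u_I, v_J)`; the module `P_I` is `P_I^I`. -/
abbrev ProjModule (I J : Set B) : Type _ :=
  IntervalModule cs K (shortestElt cs I) (longestElt cs J)

end Modules

/-! ### Projective covers and indecomposable modules -/

section Covers

variable (R : Type*) [Ring R]

/-- A submodule `N` of `P` is superfluous if `N + L = P` only for `L = P`. -/
def IsSuperfluous {P : Type*} [AddCommGroup P] [Module R P] (N : Submodule R P) : Prop :=
  ∀ L : Submodule R P, N ⊔ L = ⊤ → L = ⊤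

/-- `P` is the projective cover of `X`: it is projective, and there is an epimorphism from `P`
onto `X` with superfluous kernel. -/
def IsProjectiveCover (P X : Type*) [AddCommGroup P] [Module R P] [AddCommGroup X] [Module R X] :
    Prop :=
  Module.Projective R P ∧
    ∃ f : P →ₗ[R] X, Function.Surjective f ∧ IsSuperfluous R (LinearMap.ker f)

/-- A module is indecomposable if it is nonzero and not the direct sum of two nonzero
submodules. -/
def IsIndecomposable (P : Type*) [AddCommGroup P] [Module R P] : Prop :=
  Nontrivial P ∧ ∀ N L : Submodule R P, IsCompl N L → N = ⊥ ∨ L = ⊥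

end Covers

end ZeroHecke

/-! The interval `[u_I, v_J]_L` is the set of all `w` with `I ⊆ D_R(w) ⊆ J`, hence the disjoint
union of the descent classes of the sets `X` between `I` and `J`. So `P_I^J` and the sum of the
`P_X` have the same dimension, and a triangular map identifies them.

Let `θ` be the alternating sum of the `π_z`, with `z` in the parabolic subgroup of the complement of
`X`. Then `π_t θ = 0` for `t ∉ X`, which makes `w ↦ π_w θ u_I` a homomorphism from `P_X` to `P_I^J`
(`projMap`). It sends `w` to `w` plus longer elements. Jointly these maps are therefore bijective
(`sumMap_bijective`). For `I = ∅`, `J = S` the target is a direct summand of the regular module, so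
every `P_X`, and then every `P_I^J`, is projective.

For the cover, a proper submodule `L` of `P_I^J` is killed by a nonzero functional on which the
algebra acts by a character (`exists_eigenfunctional`). The character is given by a set `C` with `I
⊆ C ⊆ J`, and it determines the functional up to a scalar. The functional lives on the elements of
the parabolic subgroup of `C`. These lie below every `w` with `D_R(w) = J`, so it also kills the
kernel of `P_I^J → B(u_I, w)`, and kernel and `L` cannot span. If `I = J`, only `C = I` is possible,
so all proper submodules lie in one hyperplane and `P_I` is indecomposable. If `I ≠ J`, the sum has
the two nonzero summands `P_I` and `P_J`.

The group theory rests on two facts. The product of two simple reflections has order exactly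
`m(s,t)`, by the geometric representation. The elements `π_w` do not depend on the reduced word, by
Matsumoto's theorem; its proof uses that left and right multiplication operators on `W` commute. -/

namespace ZeroHecke

open CoxeterSystem

/-! ### The geometric representation and the orders of products of simple reflections -/

section GeometricRepresentation

open Polynomial.Chebyshev

variable {B : Type*} (M : CoxeterMatrix B)

/-- The linear form `x ↦ 2 B(α_i, x)` of the geometric representation. -/
noncomputable def geomCoroot (i : B) : Module.Dual ℝ (B →₀ ℝ) :=
  Finsupp.linearCombination ℝ fun j => -2 * Real.cos (Real.pi / M i j)

theorem geomCoroot_single (i j : B) :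
    geomCoroot M i (Finsupp.single j 1) = -2 * Real.cos (Real.pi / M i j) := by
  simp [geomCoroot]

theorem geomCoroot_self (i : B) : geomCoroot M i (Finsupp.single i 1) = 2 := by
  simp [geomCoroot_single]

/-- The simple reflections of the geometric representation. -/
noncomputable def geomReflection (i : B) : (B →₀ ℝ) ≃ₗ[ℝ] (B →₀ ℝ) :=
  Module.reflection (geomCoroot_self M i)

/-- The formula for powers of a product of two reflections is in Chebyshev polynomials evaluated at
this number; it is `2 cos 2θ` with `θ = π / m`. -/
theorem geomCoroot_mul (i j : B) :
    2 * Real.cos (2 * (Real.pi / M i j)) = geomCoroot M i (Finsupp.single j 1) *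
      geomCoroot M j (Finsupp.single i 1) - 2 := by
  rw [geomCoroot_single, geomCoroot_single, M.symmetric j i, Real.cos_two_mul]
  ring

theorem sin_two_pi_div_pos {m : ℕ} (hm : 3 ≤ m) : 0 < Real.sin (2 * (Real.pi / m)) := by
  have hm' : (3 : ℝ) ≤ m := by exact_mod_cast hm
  have hpi := Real.pi_pos
  apply Real.sin_pos_of_pos_of_lt_pi
  · positivity
  · rw [← mul_div_assoc, div_lt_iff₀ (by linarith)]
    nlinarith

/-- The coefficients in the power formula contain the factor `S_{k-1}` if `m = 2k`, and `S_k +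
S_{k-1}` if `m = 2k + 1`. Since `S_n(2 cos 2θ) sin 2θ = sin (2(n+1)θ)`, these factors vanish at `θ =
π / m`. -/
theorem geomReflection_pow_eq_one (i j : B) :
    (geomReflection M i * geomReflection M j) ^ M i j = 1 := by
  -- For `m < 3` the factor `sin (2π / m)` is zero and cannot be cancelled (for `m = 0` because `π /
  -- 0 = 0`).
  rcases Nat.lt_or_ge (M i j) 3 with h3 | h3
  · have h : M i j = 0 ∨ M i j = 1 ∨ M i j = 2 := by omega
    rcases h with h | h | h
    · rw [h, pow_zero]
    · have hij : i = j := by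
        by_contra hij
        exact M.off_diagonal i j hij h
      subst hij
      rw [h, pow_one]
      apply LinearEquiv.ext
      intro z
      exact Module.involutive_reflection (geomCoroot_self M i) z
    · have e1 : geomCoroot M i (Finsupp.single j 1) = 0 := by simp [geomCoroot_single, h]
      have e2 : geomCoroot M j (Finsupp.single i 1) = 0 := by
        simp [geomCoroot_single, M.symmetric j i, h]
      apply LinearEquiv.ext
      intro z
      rw [geomReflection, geomReflection, Module.reflection_mul_reflection_pow_apply, h, e1, e2]
      norm_num
      abel
  · apply LinearEquiv.ext
    intro z
    rw [geomReflection, geomReflection, Module.reflection_mul_reflection_pow_apply _ _ _ _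
      _ (geomCoroot_mul M i j)]
    have hs := (sin_two_pi_div_pos h3).ne'
    have hpi : (M i j : ℝ) * (Real.pi / M i j) = Real.pi := by
      have : (M i j : ℝ) ≠ 0 := by positivity
      field_simp
    generalize Real.pi / M i j = θ at hs hpi ⊢
    have S_sin := fun n => S_two_mul_real_cos (2 * θ) n
    generalize M i j = m at *
    rcases Nat.even_or_odd' m with ⟨k, rfl | rfl⟩
    · have h0 : (S ℝ (k - 1 : ℤ)).eval (2 * Real.cos (2 * θ)) = 0 := by
        have := S_sin (k - 1)
        rw [show (((k - 1 : ℤ) : ℝ) + 1) * (2 * θ) = Real.pi by push_cast at hpi ⊢; linarith,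
          Real.sin_pi] at this
        exact (mul_eq_zero.mp this).resolve_right hs
      rw [show (((2 * k : ℕ) : ℤ) - 2) / 2 = k - 1 by omega,
        show (((2 * k : ℕ) : ℤ) - 1) / 2 = k - 1 by omega, h0]
      simp
    · have h0 : (S ℝ (k : ℤ)).eval (2 * Real.cos (2 * θ)) +
          (S ℝ (k - 1 : ℤ)).eval (2 * Real.cos (2 * θ)) = 0 := by
        have h1 := S_sin k
        have h2 := S_sin (k - 1)
        rw [show (((k - 1 : ℤ) : ℝ) + 1) * (2 * θ) = Real.pi - θ by push_cast at hpi ⊢; linarith,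
          Real.sin_pi_sub] at h2
        rw [show (((k : ℤ) : ℝ) + 1) * (2 * θ) = θ + Real.pi by push_cast at hpi ⊢; linarith,
          Real.sin_add_pi] at h1
        have : ((S ℝ (k : ℤ)).eval (2 * Real.cos (2 * θ)) +
          (S ℝ (k - 1 : ℤ)).eval (2 * Real.cos (2 * θ))) * Real.sin (2 * θ) = 0 := by
          rw [add_mul, h1, h2]; ring
        exact (mul_eq_zero.mp this).resolve_right hs
      rw [show (((2 * k + 1 : ℕ) : ℤ) - 2) / 2 = k - 1 by omega,
        show (((2 * k + 1 : ℕ) : ℤ) - 1) / 2 = k by omega,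
        show (((2 * k + 1 : ℕ) : ℤ) - 3) / 2 = k - 1 by omega,
        show (((2 * k + 1 : ℕ) : ℤ)) / 2 = k by omega, h0]
      simp

/-- Apply the power to `α_i`. If it is the identity, the `α_j` coefficient forces `S_{d-1} = 0`,
that is `sin 2dθ = 0`, and `0 < d < m` leaves only `2dθ = π`. Then `S_d sin 2θ = - sin 2θ`, while
the `α_i` coefficient forces `S_d = 1`. -/
theorem geomReflection_pow_ne_one {i j : B} (hij : i ≠ j) {d : ℕ} (hd : 0 < d)
    (hdm : d < M i j ∨ M i j = 0) : (geomReflection M i * geomReflection M j) ^ d ≠ 1 := by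
  intro h
  have h1 := LinearEquiv.congr_fun h (Finsupp.single i 1)
  rw [geomReflection, geomReflection, Module.reflection_mul_reflection_pow_apply_self _ _ _ _
      (geomCoroot_mul M i j)] at h1
  have hi := DFunLike.congr_fun h1 i
  have hj := DFunLike.congr_fun h1 j
  simp only [LinearEquiv.coe_one, id_eq, Finsupp.coe_add, Finsupp.coe_smul, Pi.add_apply,
    Pi.smul_apply, Finsupp.single_eq_same, Finsupp.single_eq_of_ne hij, smul_eq_mul, mul_one,
    Finsupp.single_eq_of_ne hij.symm, mul_zero, add_zero, zero_add, geomCoroot_single] at hi hj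
  rw [M.symmetric j i] at hj
  have hd' : (0 : ℝ) < d := by exact_mod_cast hd
  rcases Nat.eq_zero_or_pos (M i j) with h0 | hpos
  -- Here `π / 0 = 0`, so the cosine is `1`, as is usual for `m = ∞`, and `S_{d-1}(2) = d` is not
  -- zero.
  · rw [h0] at hj
    simp [S_eval_two] at hj
    omega
  have hdm : d < M i j := by omega
  have hdm' : (d : ℝ) < M i j := by exact_mod_cast hdm
  have hM : M i j ≠ 1 := M.off_diagonal i j hij
  rcases Nat.lt_or_ge (M i j) 3 with h3 | h3
  · have h2 : M i j = 2 := by omega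
    have hd1 : d = 1 := by omega
    rw [h2, hd1] at hi
    norm_num [mul_div_cancel₀] at hi
  · have hs := (sin_two_pi_div_pos h3).ne'
    have hpi : (M i j : ℝ) * (Real.pi / M i j) = Real.pi := by
      have : (M i j : ℝ) ≠ 0 := by positivity
      field_simp
    have hc : 0 < Real.cos (Real.pi / M i j) := by
      have : (3 : ℝ) ≤ M i j := by exact_mod_cast h3
      have hp := Real.pi_pos
      apply Real.cos_pos_of_mem_Ioo
      constructor
      · have : 0 < Real.pi / M i j := by positivity
        linarith
      · gcongr
        linarith
    have hθ : 0 < Real.pi / M i j := by have := Real.pi_pos; positivity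
    generalize Real.pi / M i j = θ at *
    have hS1 := S_two_mul_real_cos (2 * θ) (d - 1)
    have hS2 := S_two_mul_real_cos (2 * θ) d
    have hz : (S ℝ (d - 1 : ℤ)).eval (2 * Real.cos (2 * θ)) = 0 := by
      rcases mul_eq_zero.mp hj with h | h
      · exact h
      · linarith
    rw [hz, zero_mul] at hS1
    rw [hz, add_zero] at hi
    rw [hi, one_mul] at hS2
    push_cast at hS1 hS2
    have e1 : Real.sin (2 * d * θ) = 0 := by rw [hS1]; ring_nf
    have e2 : 2 * d * θ = Real.pi := by
      obtain ⟨n, hn⟩ := Real.sin_eq_zero_iff.mp e1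
      have hp := Real.pi_pos
      have h1 : 0 < (n : ℝ) * Real.pi := by rw [hn]; positivity
      have h2 : (n : ℝ) * Real.pi < 2 * Real.pi := by rw [hn, ← hpi]; nlinarith
      have h3 : (0 : ℝ) < n := pos_of_mul_pos_left h1 hp.le
      have h4 : (n : ℝ) < 2 := lt_of_mul_lt_mul_right h2 hp.le
      have h5 : n = 1 := by
        have : (0 : ℤ) < n := by exact_mod_cast h3
        have : n < 2 := by exact_mod_cast h4
        omega
      rw [← hn, h5]; simp
    rw [show ((d : ℝ) + 1) * (2 * θ) = 2 * θ + Real.pi by linarith, Real.sin_add_pi] at hS2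
    exact hs (by linarith)

variable {M} {W : Type*} [Group W] (cs : CoxeterSystem M W)

/-- In a finite Coxeter group, the order of a product of two simple reflections is the entry of the
Coxeter matrix. -/
theorem orderOf_simple_mul_simple [Finite W] (i j : B) :
    orderOf (cs.simple i * cs.simple j) = M i j := by
  have key : ∀ d : ℕ, (cs.simple i * cs.simple j) ^ d = 1 →
      (geomReflection M i * geomReflection M j) ^ d = 1 := by
    intro d h
    have hl : M.IsLiftable (geomReflection M) := geomReflection_pow_eq_one M
    have := congrArg (cs.lift ⟨geomReflection M, hl⟩) h
    rwa [map_pow, map_mul, cs.lift_apply_simple, cs.lift_apply_simple, map_one] at this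
  by_cases hij : i = j
  · subst hij; simp
  have hd := orderOf_pos (cs.simple i * cs.simple j)
  have h1 := key _ (pow_orderOf_eq_one (cs.simple i * cs.simple j))
  have h2 := geomReflection_pow_ne_one M hij hd
  have h3 := orderOf_dvd_of_pow_eq_one (cs.simple_mul_simple_pow i j)
  by_contra hne
  refine h2 ?_ h1
  -- The entry `0` is not excluded beforehand; it is refuted because finiteness of `W` gives a
  -- positive order `d`.
  rcases Nat.eq_zero_or_pos (M i j) with h | h
  · exact Or.inr h
  · exact Or.inl (lt_of_le_of_ne (Nat.le_of_dvd h h3) hne)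

end GeometricRepresentation

section Combinatorics

variable {B W : Type*} [Group W] {M : CoxeterMatrix B} (cs : CoxeterSystem M W)

/-! ### Left and right operators -/

open Classical in
/-- The operator on `W` that sends `w` to `w` if `s_i` is a right descent of `w`, and to `w s_i`
otherwise. -/
noncomputable def rightStep (i : B) (w : W) : W :=
  if cs.IsRightDescent w i then w else w * cs.simple i

/-- The composite of the right operators of a word, the first letter acting first. -/
noncomputable def rightAct : List B → W → W
  | [], w => w
  | i :: ω, w => rightAct ω (rightStep cs i w)

theorem step_of_isLeftDescent {w : W} {i : B} (h : cs.IsLeftDescent w i) : step cs i w = w := by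
  rw [step, if_pos h]

theorem step_of_not_isLeftDescent {w : W} {i : B} (h : ¬ cs.IsLeftDescent w i) :
    step cs i w = cs.simple i * w := by
  rw [step, if_neg h]

theorem rightStep_of_isRightDescent {w : W} {i : B} (h : cs.IsRightDescent w i) :
    rightStep cs i w = w := by
  rw [rightStep, if_pos h]

theorem rightStep_of_not_isRightDescent {w : W} {i : B} (h : ¬ cs.IsRightDescent w i) :
    rightStep cs i w = w * cs.simple i := by
  rw [rightStep, if_neg h]

/-- The exchange property for a left and a right multiplication. -/
theorem simple_mul_eq_mul_simple {w : W} {i j : B} (hi : ¬ cs.IsLeftDescent w i)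
    (h : cs.IsLeftDescent (w * cs.simple j) i) : cs.simple i * w = w * cs.simple j := by
  classical
  rw [isLeftDescent_iff_eta, not_not] at hi
  rw [isLeftDescent_iff_eta, eta_mul] at h
  have e1 : cs.simple j * ((w * cs.simple j)⁻¹ * cs.simple i * (w * cs.simple j)) *
      (cs.simple j)⁻¹ = w⁻¹ * cs.simple i * w := by
    simp [mul_assoc]
  rw [e1, hi, add_zero, eta_simple] at h
  -- Appending `s_j` changes the parity at the relevant reflection, and it does so at `s_j` alone.
  have h2 : (w * cs.simple j)⁻¹ * cs.simple i * (w * cs.simple j) = cs.simple j := by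
    by_contra h'
    exact h (if_neg h')
  have h3 : w⁻¹ * cs.simple i * w = cs.simple j := by
    rw [← e1, h2]; simp
  rw [← h3]; group

/-- Length counts settle all cases but one: both multiplications lengthen `w`, and `s_i` is a left
descent of `w s_j`. Then `s_i w = w s_j` by exchange, and both composites equal this element. -/
theorem step_rightStep (i j : B) (w : W) :
    step cs i (rightStep cs j w) = rightStep cs j (step cs i w) := by
  by_cases hi : cs.IsLeftDescent w i <;> by_cases hj : cs.IsRightDescent w j
  · rw [step_of_isLeftDescent cs hi, rightStep_of_isRightDescent cs hj,
      step_of_isLeftDescent cs hi]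
  · rw [step_of_isLeftDescent cs hi, rightStep_of_not_isRightDescent cs hj]
    apply step_of_isLeftDescent
    unfold IsLeftDescent at *
    rw [not_isRightDescent_iff] at hj
    have := cs.length_mul_le (cs.simple i * w) (cs.simple j)
    rw [cs.length_simple, mul_assoc] at this
    have h2 := cs.length_simple_mul_ne (w * cs.simple j) i
    omega
  · rw [step_of_not_isLeftDescent cs hi, rightStep_of_isRightDescent cs hj,
      step_of_not_isLeftDescent cs hi]
    symm
    apply rightStep_of_isRightDescent
    unfold IsRightDescent at *
    rw [not_isLeftDescent_iff] at hi
    have := cs.length_mul_le (cs.simple i) (w * cs.simple j)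
    rw [cs.length_simple, ← mul_assoc] at this
    have h2 := cs.length_mul_simple_ne (cs.simple i * w) j
    omega
  · rw [step_of_not_isLeftDescent cs hi, rightStep_of_not_isRightDescent cs hj]
    by_cases h : cs.IsLeftDescent (w * cs.simple j) i
    · have e := simple_mul_eq_mul_simple cs hi h
      rw [step_of_isLeftDescent cs h, rightStep_of_isRightDescent cs, e]
      unfold IsRightDescent
      rw [e, cs.simple_mul_simple_cancel_right]
      rw [not_isRightDescent_iff] at hj
      omega
    · rw [step_of_not_isLeftDescent cs h, rightStep_of_not_isRightDescent cs, mul_assoc]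
      rw [not_isLeftDescent_iff, ← mul_assoc] at h
      rw [not_isRightDescent_iff] at hj ⊢
      rw [not_isLeftDescent_iff] at hi
      omega

theorem step_rightAct (i : B) (τ : List B) (w : W) :
    step cs i (rightAct cs τ w) = rightAct cs τ (step cs i w) := by
  induction τ generalizing w with
  | nil => rfl
  | cons j τ ih => rw [rightAct, ih, step_rightStep, rightAct]

theorem act_rightAct (ω τ : List B) (w : W) :
    act cs ω (rightAct cs τ w) = rightAct cs τ (act cs ω w) := by
  induction ω with
  | nil => rfl
  | cons i ω ih => rw [act, ih, step_rightAct, act]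

theorem isReduced_of_cons {i : B} {ω : List B} (h : cs.IsReduced (i :: ω)) : cs.IsReduced ω :=
  h.drop 1

theorem not_isLeftDescent_of_isReduced_cons {i : B} {ω : List B} (h : cs.IsReduced (i :: ω)) :
    ¬ cs.IsLeftDescent (cs.wordProd ω) i := by
  have h1 := isReduced_of_cons cs h
  unfold CoxeterSystem.IsReduced at h h1
  rw [cs.wordProd_cons] at h
  rw [not_isLeftDescent_iff, h, h1, List.length_cons]

theorem isReduced_cons {i : B} {ω : List B} (hω : cs.IsReduced ω)
    (h : ¬ cs.IsLeftDescent (cs.wordProd ω) i) : cs.IsReduced (i :: ω) := by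
  unfold CoxeterSystem.IsReduced at hω ⊢
  rw [not_isLeftDescent_iff, hω] at h
  rw [cs.wordProd_cons, h, List.length_cons]

theorem exists_isReduced_cons {w : W} {i : B} (h : cs.IsLeftDescent w i) :
    ∃ ω, cs.IsReduced (i :: ω) ∧ w = cs.wordProd (i :: ω) := by
  obtain ⟨ω, hω, e⟩ := cs.exists_isReduced (cs.simple i * w)
  have e' : w = cs.wordProd (i :: ω) := by
    rw [cs.wordProd_cons, ← e, cs.simple_mul_simple_cancel_left]
  refine ⟨ω, isReduced_cons cs hω ?_, e'⟩
  rw [← e]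
  exact cs.isLeftDescent_iff_not_isLeftDescent_mul.mp h

theorem act_one_of_isReduced {ω : List B} (h : cs.IsReduced ω) :
    act cs ω 1 = cs.wordProd ω := by
  induction ω with
  | nil => simp [act]
  | cons i ω ih =>
    rw [act, ih (isReduced_of_cons cs h),
      step_of_not_isLeftDescent cs (not_isLeftDescent_of_isReduced_cons cs h), cs.wordProd_cons]

theorem rightAct_of_isReduced {ω : List B} {x : W}
    (h : cs.length (x * cs.wordProd ω) = cs.length x + ω.length) :
    rightAct cs ω x = x * cs.wordProd ω := by
  induction ω generalizing x with
  | nil => simp [rightAct]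
  | cons i ω ih =>
    rw [cs.wordProd_cons, ← mul_assoc, List.length_cons] at h
    have h1 := cs.length_mul_le (x * cs.simple i) (cs.wordProd ω)
    have h2 := cs.length_wordProd_le ω
    have h3 := cs.length_mul_simple x i
    have hx : ¬ cs.IsRightDescent x i := by rw [not_isRightDescent_iff]; omega
    rw [rightAct, rightStep_of_not_isRightDescent cs hx, ih (by omega), cs.wordProd_cons,
      mul_assoc]

/-- Letters that are right descents when their turn comes are skipped and all others lengthen, so
`b` is the product of the letters that are kept. -/
theorem exists_rightAct (τ : List B) (x : W) :
    ∃ b, rightAct cs τ x = x * b ∧ cs.length (x * b) = cs.length x + cs.length b := by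
  suffices H : ∀ x, ∃ ρ : List B, rightAct cs τ x = x * cs.wordProd ρ ∧
      cs.length (x * cs.wordProd ρ) = cs.length x + ρ.length by
    obtain ⟨ρ, h1, h2⟩ := H x
    refine ⟨_, h1, ?_⟩
    have := cs.length_mul_le x (cs.wordProd ρ)
    have := cs.length_wordProd_le ρ
    omega
  induction τ with
  | nil => exact fun x => ⟨[], by simp [rightAct]⟩
  | cons i τ ih =>
    intro x
    obtain ⟨ρ, h1, h2⟩ := ih (rightStep cs i x)
    rw [rightAct, h1]
    by_cases hx : cs.IsRightDescent x i
    · rw [rightStep_of_isRightDescent cs hx] at h2 ⊢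
      exact ⟨ρ, rfl, h2⟩
    · rw [rightStep_of_not_isRightDescent cs hx] at h2 ⊢
      rw [not_isRightDescent_iff] at hx
      refine ⟨i :: ρ, by rw [cs.wordProd_cons, mul_assoc], ?_⟩
      rw [cs.wordProd_cons, ← mul_assoc, h2, hx, List.length_cons]
      ring

/-- If all letters of a reduced word are left descents of `y`, then that word is an initial segment
of a reduced word for `y`. -/
theorem exists_eq_wordProd_mul {ω : List B} (hω : cs.IsReduced ω) {y : W}
    (h : ∀ i ∈ ω, cs.IsLeftDescent y i) :
    ∃ b, y = cs.wordProd ω * b ∧ cs.length y = cs.length (cs.wordProd ω) + cs.length b := by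
  obtain ⟨τ, hτ, e⟩ := cs.exists_isReduced y
  have h1 : rightAct cs τ 1 = y := by
    rw [rightAct_of_isReduced, one_mul, e]
    rw [one_mul, cs.length_one, zero_add]; exact hτ
  -- Write `y` as the right operator of `τ` applied to `1`. As `ω` fixes `y` from the left and the
  -- two kinds of operators commute, `y` is also the right operator of `τ` applied to the product of
  -- `ω`.
  have h2 : act cs ω y = y := by
    clear hω
    induction ω with
    | nil => rfl
    | cons i ω ih =>
      rw [act, ih fun j hj => h j (List.mem_cons_of_mem _ hj)]
      exact step_of_isLeftDescent cs (h i List.mem_cons_self)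
  obtain ⟨b, hb, hb'⟩ := exists_rightAct cs τ (cs.wordProd ω)
  have h3 : y = cs.wordProd ω * b := by
    rw [← hb, ← act_one_of_isReduced cs hω, ← act_rightAct, h1, h2]
  exact ⟨b, h3, by rw [← hb', ← h3]⟩

/-! ### Matsumoto's theorem -/

section Matsumoto

variable [Finite W]

theorem coxeterMatrix_pos (cs : CoxeterSystem M W) (i j : B) : 0 < M i j := by
  rw [← orderOf_simple_mul_simple cs]
  exact orderOf_pos _

theorem length_alt (i j : B) {k : ℕ} (hk : k ≤ M i j) : cs.length (alt cs i j k) = k := by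
  induction k with
  | zero => simp [alt_zero]
  | succ k ih =>
    -- With `D = ⊤` the element of minimal length is `1`. All `k < M i j` are covered because the
    -- order of `s_j s_i` is exactly `M i j`.
    have h := not_isLeftDescent_alt cs (D := ⊤) (y := 1) (i := i) (j := j) (k := k)
      (fun x _ => by simp) trivial trivial
      (by rw [orderOf_simple_mul_simple, ← M.symmetric]; exact hk)
    rw [mul_one, not_isLeftDescent_iff, ← alt_succ, ih (by omega)] at h
    exact h

theorem isReduced_alternatingWord (i j : B) : cs.IsReduced (alternatingWord i j (M i j)) := by
  have := length_alt cs j i (k := M i j) (by rw [M.symmetric])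
  unfold CoxeterSystem.IsReduced
  rw [length_alternatingWord]
  exact this

theorem wordProd_alternatingWord_comm (i j : B) :
    cs.wordProd (alternatingWord i j (M i j)) = cs.wordProd (alternatingWord j i (M i j)) := by
  have := alt_orderOf cs j i
  rw [orderOf_simple_mul_simple] at this
  exact this

theorem mem_alternatingWord {i j l : B} {m : ℕ} (h : l ∈ alternatingWord i j m) :
    l = i ∨ l = j := by
  induction m generalizing i j with
  | zero => simp [alternatingWord] at h
  | succ m ih =>
    rw [alternatingWord_succ, List.concat_eq_append, List.mem_append, List.mem_singleton] at h
    rcases h with h | h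
    · exact (ih h).symm
    · exact Or.inr h

/-- Matsumoto's theorem: a map on letters to a monoid that satisfies the braid relations takes the
same value on all reduced words of an element. -/
theorem prod_map_eq_of_isReduced {G : Type*} [Monoid G] (f : B → G)
    (hf : ∀ i j, i ≠ j → ((alternatingWord i j (M i j)).map f).prod =
      ((alternatingWord j i (M i j)).map f).prod) {ω ω' : List B} (h : cs.IsReduced ω)
    (h' : cs.IsReduced ω') (e : cs.wordProd ω = cs.wordProd ω') :
    (ω.map f).prod = (ω'.map f).prod := by
  induction hn : ω.length generalizing ω ω' with
  | zero =>
    have : ω'.length = 0 := by rw [← h', ← e, h, hn]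
    rw [List.length_eq_zero_iff] at hn this
    rw [hn, this]
  | succ n ih =>
    have hlen : ω'.length = n + 1 := by rw [← h', ← e, h, hn]
    have same : ∀ {i : B} {α β : List B}, α.length = n → cs.IsReduced (i :: α) →
        cs.IsReduced (i :: β) → cs.wordProd (i :: α) = cs.wordProd (i :: β) →
        ((i :: α).map f).prod = ((i :: β).map f).prod := by
      intro i α β hα h1 h2 e
      rw [cs.wordProd_cons, cs.wordProd_cons, mul_right_inj] at e
      rw [List.map_cons, List.prod_cons, List.map_cons, List.prod_cons,
        ih (isReduced_of_cons cs h1) (isReduced_of_cons cs h2) e hα]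
    obtain ⟨i, α, rfl⟩ := List.exists_of_length_succ ω hn
    obtain ⟨j, β, rfl⟩ := List.exists_of_length_succ ω' hlen
    simp only [List.length_cons, Nat.add_right_cancel_iff] at hn hlen
    by_cases hij : i = j
    · subst hij
      exact same hn h h' e
    have di : cs.IsLeftDescent (cs.wordProd (i :: α)) i := by
      have := not_isLeftDescent_of_isReduced_cons cs h
      rw [cs.wordProd_cons, isLeftDescent_iff_not_isLeftDescent_mul,
        cs.simple_mul_simple_cancel_left]
      exact this
    have dj : cs.IsLeftDescent (cs.wordProd (i :: α)) j := by
      have := not_isLeftDescent_of_isReduced_cons cs h'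
      rw [e, cs.wordProd_cons, isLeftDescent_iff_not_isLeftDescent_mul,
        cs.simple_mul_simple_cancel_left]
      exact this
    -- Both first letters are left descents, so the element also has reduced words that start with
    -- either of the two braid words. These link `i :: α` to `j :: β`: a shared first letter is
    -- handled by induction, and the link itself is the braid relation.
    obtain ⟨b, hb, hb'⟩ := exists_eq_wordProd_mul cs (isReduced_alternatingWord cs i j)
      (y := cs.wordProd (i :: α)) (fun l hl => by
        rcases mem_alternatingWord hl with rfl | rfl
        · exact di
        · exact dj)
    obtain ⟨τ, hτ, rfl⟩ := cs.exists_isReduced b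
    have hword : ∀ p q : B, (p = i ∧ q = j) ∨ (p = j ∧ q = i) →
        cs.wordProd (alternatingWord p q (M i j) ++ τ) = cs.wordProd (i :: α) ∧
        cs.IsReduced (alternatingWord p q (M i j) ++ τ) := by
      intro p q hpq
      have e1 : cs.wordProd (alternatingWord p q (M i j) ++ τ) = cs.wordProd (i :: α) := by
        rw [cs.wordProd_append, hb]
        rcases hpq with ⟨rfl, rfl⟩ | ⟨rfl, rfl⟩
        · rfl
        · rw [wordProd_alternatingWord_comm cs q p]
      refine ⟨e1, ?_⟩
      unfold CoxeterSystem.IsReduced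
      rw [e1, hb', isReduced_alternatingWord, hτ, List.length_append, length_alternatingWord,
        length_alternatingWord]
    have hprod : ((alternatingWord i j (M i j) ++ τ).map f).prod =
        ((alternatingWord j i (M i j) ++ τ).map f).prod := by
      rw [List.map_append, List.map_append, List.prod_append, List.prod_append, hf i j hij]
    obtain ⟨m, hm⟩ : ∃ m, M i j = m + 1 :=
      ⟨M i j - 1, (Nat.sub_add_cancel (coxeterMatrix_pos cs i j)).symm⟩
    have hhead : ∀ p q : B, (p = i ∧ q = j) ∨ (p = j ∧ q = i) → ∃ ρ,
        alternatingWord p q (M i j) ++ τ = (if Even m then q else p) :: ρ := by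
      intro p q _
      rw [hm, alternatingWord_succ']
      exact ⟨_, rfl⟩
    have first : ∀ p q : B, (p = i ∧ q = j) ∨ (p = j ∧ q = i) → (if Even m then q else p) = i →
        ((i :: α).map f).prod = ((alternatingWord p q (M i j) ++ τ).map f).prod := by
      intro p q hpq hi
      obtain ⟨ρ, hρ⟩ := hhead p q hpq
      obtain ⟨h1, h2⟩ := hword p q hpq
      rw [hρ, hi] at h1 h2 ⊢
      exact same hn h h2 h1.symm
    have second : ∀ p q : B, (p = i ∧ q = j) ∨ (p = j ∧ q = i) → (if Even m then q else p) = j →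
        ((j :: β).map f).prod = ((alternatingWord p q (M i j) ++ τ).map f).prod := by
      intro p q hpq hi
      obtain ⟨ρ, hρ⟩ := hhead p q hpq
      obtain ⟨h1, h2⟩ := hword p q hpq
      rw [hρ, hi] at h1 h2 ⊢
      exact same hlen h' h2 (h1.trans e).symm
    -- The parity of `m = M i j - 1` decides which braid word begins with `i`.
    by_cases hm' : Even m
    · rw [first j i (Or.inr ⟨rfl, rfl⟩) (if_pos hm'), second i j (Or.inl ⟨rfl, rfl⟩) (if_pos hm'),
        hprod]
    · rw [first i j (Or.inl ⟨rfl, rfl⟩) (if_neg hm'), second j i (Or.inr ⟨rfl, rfl⟩) (if_neg hm'),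
        hprod]

end Matsumoto

end Combinatorics

section HeckeBasis

variable {B W : Type*} [Group W] {M : CoxeterMatrix B} (K : Type*) [Field K]

/-! ### The elements `π_w` of the `0`-Hecke algebra -/

open HeckeAlgebra in
theorem gen_mul_self (i : B) : gen M K i * gen M K i = gen M K i := by
  have := RingQuot.mkAlgHom_rel K (HeckeRel.idem (M := M) (K := K) i)
  rwa [map_mul] at this

open HeckeAlgebra in
theorem gen_braid (i j : B) (h : i ≠ j) : ((alternatingWord i j (M i j)).map (gen M K)).prod =
    ((alternatingWord j i (M i j)).map (gen M K)).prod := by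
  have := RingQuot.mkAlgHom_rel K (HeckeRel.braid (M := M) (K := K) i j h)
  rw [map_list_prod, map_list_prod, List.map_map, List.map_map] at this
  exact this

/-- An induction principle for the `0`-Hecke algebra. -/
theorem heckeAlgebra_induction {p : HeckeAlgebra M K → Prop} (h : HeckeAlgebra M K)
    (algebraMap : ∀ a, p (algebraMap K _ a)) (gen : ∀ i, p (HeckeAlgebra.gen M K i))
    (add : ∀ x y, p x → p y → p (x + y)) (mul : ∀ x y, p x → p y → p (x * y)) : p h := by
  obtain ⟨x, rfl⟩ := RingQuot.mkAlgHom_surjective K (HeckeRel M K) h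
  induction x using FreeAlgebra.induction with
  | grade0 a => rw [AlgHom.commutes]; exact algebraMap a
  | grade1 i => exact gen i
  | mul x y hx hy => rw [map_mul]; exact mul _ _ hx hy
  | add x y hx hy => rw [map_add]; exact add _ _ hx hy

/-- A linear map of modules over the `0`-Hecke algebra that commutes with the generators is a
module homomorphism. -/
def heckeLinearMap {N N' : Type*} [AddCommGroup N] [Module K N] [Module (HeckeAlgebra M K) N]
    [IsScalarTower K (HeckeAlgebra M K) N] [AddCommGroup N'] [Module K N']
    [Module (HeckeAlgebra M K) N'] [IsScalarTower K (HeckeAlgebra M K) N'] (f : N →ₗ[K] N')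
    (hf : ∀ i x, f (HeckeAlgebra.gen M K i • x) = HeckeAlgebra.gen M K i • f x) :
    N →ₗ[HeckeAlgebra M K] N' where
  toFun := f
  map_add' := map_add f
  map_smul' h x := by
    induction h using heckeAlgebra_induction generalizing x with
    | algebraMap a => simp
    | gen i => exact hf i x
    | add h h' ih ih' => simp [add_smul, ih, ih']
    | mul h h' ih ih' => simp only [RingHom.id_apply] at ih ih' ⊢; rw [mul_smul, ih, ih', mul_smul]

/-! ### One-dimensional characters -/

open Classical in
/-- The value at `π_i` of the character of a set of generators. -/
noncomputable def charValue (C : Set B) (i : B) : K := if i ∈ C then 1 else 0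

/-- The values are commuting idempotents, so repetitions do not matter; with two or more factors
both letters occur. -/
theorem charValue_prod_alternatingWord (C : Set B) (i j : B) (m : ℕ) (hm : 2 ≤ m) :
    ((alternatingWord i j m).map (charValue K C)).prod = charValue K C i * charValue K C j := by
  induction m, hm using Nat.le_induction with
  | base => simp [alternatingWord]
  | succ m hm ih =>
    rw [alternatingWord_succ', List.map_cons, List.prod_cons, ih]
    by_cases h : Even m <;> by_cases hi : i ∈ C <;> by_cases hj : j ∈ C <;>
      simp [charValue, h, hi, hj]

theorem charValue_rel (C : Set B) ⦃x y : FreeAlgebra K B⦄ (h : HeckeRel M K x y) :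
    FreeAlgebra.lift K (charValue K C) x = FreeAlgebra.lift K (charValue K C) y := by
  cases h with
  | idem i =>
    rw [map_mul, FreeAlgebra.lift_ι_apply, charValue]
    split_ifs <;> simp
  | braid i j h =>
    rw [map_list_prod, map_list_prod, List.map_map, List.map_map]
    have e : (FreeAlgebra.lift K (charValue K C) : FreeAlgebra K B → K) ∘ FreeAlgebra.ι K
        = charValue K C := by
      funext l; simp
    rw [e]
    rcases Nat.lt_or_ge (M i j) 2 with h2 | h2
    · have h1 : M i j ≠ 1 := M.off_diagonal i j h
      have h0 : M i j = 0 := by omega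
      rw [h0]; rfl
    · rw [charValue_prod_alternatingWord K C i j _ h2, charValue_prod_alternatingWord K C j i _ h2,
        mul_comm]

/-- The character of the `0`-Hecke algebra that sends `π_i` to `1` if `i ∈ C` and to `0`
otherwise. -/
noncomputable def heckeChar (C : Set B) : HeckeAlgebra M K →ₐ[K] K :=
  RingQuot.liftAlgHom K ⟨FreeAlgebra.lift K (charValue K C), charValue_rel K C⟩

theorem heckeChar_gen (C : Set B) (i : B) :
    heckeChar K C (HeckeAlgebra.gen M K i) = charValue K C i := by
  rw [heckeChar, HeckeAlgebra.gen, RingQuot.liftAlgHom_mkAlgHom_apply, FreeAlgebra.lift_ι_apply]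

theorem heckeChar_gen_of_mem {C : Set B} {i : B} (h : i ∈ C) :
    heckeChar K C (HeckeAlgebra.gen M K i) = 1 := by
  rw [heckeChar_gen, charValue, if_pos h]

theorem heckeChar_gen_of_notMem {C : Set B} {i : B} (h : i ∉ C) :
    heckeChar K C (HeckeAlgebra.gen M K i) = 0 := by
  rw [heckeChar_gen, charValue, if_neg h]

/-! ### Products of the elements `π_w`, and parabolic subgroups -/

variable (cs : CoxeterSystem M W)

/-- The element `π_w` of the `0`-Hecke algebra. -/
noncomputable def heckeElt (w : W) : HeckeAlgebra M K :=
  ((cs.exists_isReduced w).choose.map (HeckeAlgebra.gen M K)).prod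

theorem leftWeakLE_iff {u v : W} : LeftWeakLE cs u v ↔
    ∃ z, v = z * u ∧ cs.length v = cs.length z + cs.length u := by
  constructor
  · rintro ⟨ω, rfl, h⟩
    refine ⟨_, rfl, ?_⟩
    have := cs.length_mul_le (cs.wordProd ω) u
    have := cs.length_wordProd_le ω
    omega
  · rintro ⟨z, rfl, h⟩
    obtain ⟨ω, hω, rfl⟩ := cs.exists_isReduced z
    exact ⟨ω, rfl, by rw [h, hω, add_comm]⟩

/-- The value is `1` if the reduced word of `w` has all letters in `C`, and `0` otherwise. Hence a
nonzero value serves below as the definition of membership in the parabolic subgroup of `C`. -/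
theorem heckeChar_heckeElt_eq_zero_or_one (C : Set B) (w : W) :
    heckeChar K C (heckeElt K cs w) = 0 ∨ heckeChar K C (heckeElt K cs w) = 1 := by
  unfold heckeElt
  induction (cs.exists_isReduced w).choose with
  | nil => simp
  | cons i ω ih =>
    rw [List.map_cons, List.prod_cons, map_mul, heckeChar_gen, charValue]
    split_ifs
    · rwa [one_mul]
    · simp

variable [Finite W]

theorem prod_map_gen {ω : List B} (h : cs.IsReduced ω) :
    (ω.map (HeckeAlgebra.gen M K)).prod = heckeElt K cs (cs.wordProd ω) := by
  have h' := (cs.exists_isReduced (cs.wordProd ω)).choose_spec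
  exact prod_map_eq_of_isReduced cs _ (gen_braid K) h h'.1 h'.2

theorem heckeElt_one : heckeElt K cs 1 = 1 := by
  have := prod_map_gen K cs (ω := []) (by simp [CoxeterSystem.IsReduced])
  simpa using this.symm

theorem gen_mul_heckeElt (i : B) (w : W) :
    HeckeAlgebra.gen M K i * heckeElt K cs w = heckeElt K cs (step cs i w) := by
  by_cases h : cs.IsLeftDescent w i
  · obtain ⟨ω, hω, rfl⟩ := exists_isReduced_cons cs h
    rw [step_of_isLeftDescent cs h, ← prod_map_gen K cs hω, List.map_cons, List.prod_cons,
      ← mul_assoc, gen_mul_self]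
  · obtain ⟨ω, hω, rfl⟩ := cs.exists_isReduced w
    rw [step_of_not_isLeftDescent cs h, ← cs.wordProd_cons,
      ← prod_map_gen K cs (isReduced_cons cs hω h), List.map_cons, List.prod_cons,
      prod_map_gen K cs hω]

theorem gen_mul_heckeElt_of_not_isLeftDescent {i : B} {w : W} (h : ¬ cs.IsLeftDescent w i) :
    HeckeAlgebra.gen M K i * heckeElt K cs w = heckeElt K cs (cs.simple i * w) := by
  rw [gen_mul_heckeElt, step_of_not_isLeftDescent cs h]

theorem heckeElt_mul_gen_of_not_isRightDescent {i : B} {w : W} (h : ¬ cs.IsRightDescent w i) :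
    heckeElt K cs w * HeckeAlgebra.gen M K i = heckeElt K cs (w * cs.simple i) := by
  obtain ⟨ω, hω, rfl⟩ := cs.exists_isReduced w
  have e : cs.wordProd ω * cs.simple i = cs.wordProd (ω ++ [i]) := by
    rw [cs.wordProd_append, cs.wordProd_singleton]
  have hred : cs.IsReduced (ω ++ [i]) := by
    rw [not_isRightDescent_iff, e, hω] at h
    unfold CoxeterSystem.IsReduced
    rw [h, List.length_append, List.length_singleton]
  rw [e, ← prod_map_gen K cs hred, List.map_append, List.prod_append, prod_map_gen K cs hω]
  simp

theorem heckeElt_mul_gen (i : B) (w : W) :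
    heckeElt K cs w * HeckeAlgebra.gen M K i = heckeElt K cs (rightStep cs i w) := by
  by_cases h : cs.IsRightDescent w i
  · rw [rightStep_of_isRightDescent cs h]
    have h1 := cs.isRightDescent_iff_not_isRightDescent_mul.mp h
    have h2 := heckeElt_mul_gen_of_not_isRightDescent K cs h1
    rw [cs.simple_mul_simple_cancel_right] at h2
    rw [← h2, mul_assoc, gen_mul_self]
  · rw [rightStep_of_not_isRightDescent cs h, heckeElt_mul_gen_of_not_isRightDescent K cs h]

theorem heckeElt_mul_prod (ω : List B) (w : W) :
    heckeElt K cs w * (ω.map (HeckeAlgebra.gen M K)).prod = heckeElt K cs (rightAct cs ω w) := by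
  induction ω generalizing w with
  | nil => simp [rightAct]
  | cons i ω ih => rw [List.map_cons, List.prod_cons, ← mul_assoc, heckeElt_mul_gen, ih, rightAct]

theorem heckeChar_prod_ne_zero {C : Set B} {ω : List B}
    (h : heckeChar K C (ω.map (HeckeAlgebra.gen M K)).prod ≠ 0) : ∀ i ∈ ω, i ∈ C := by
  intro i hi
  by_contra hC
  apply h
  rw [map_list_prod, List.map_map]
  apply List.prod_eq_zero
  rw [List.mem_map]
  exact ⟨i, hi, heckeChar_gen_of_notMem K hC⟩

theorem heckeChar_simple_mul {C : Set B} {i : B} (hi : i ∈ C) (w : W) :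
    heckeChar K C (heckeElt K cs (cs.simple i * w)) = heckeChar K C (heckeElt K cs w) := by
  have key : ∀ w, ¬ cs.IsLeftDescent w i →
      heckeChar K C (heckeElt K cs (cs.simple i * w)) = heckeChar K C (heckeElt K cs w) := by
    intro w h
    rw [← gen_mul_heckeElt_of_not_isLeftDescent K cs h, map_mul, heckeChar_gen_of_mem K hi, one_mul]
  by_cases h : cs.IsLeftDescent w i
  · have := key _ (cs.isLeftDescent_iff_not_isLeftDescent_mul.mp h)
    rw [← this, cs.simple_mul_simple_cancel_left]
  · exact key w h

theorem heckeChar_mul_simple {C : Set B} {i : B} {w : W} (hi : i ∈ C)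
    (h : ¬ cs.IsRightDescent w i) :
    heckeChar K C (heckeElt K cs (w * cs.simple i)) = heckeChar K C (heckeElt K cs w) := by
  rw [← heckeElt_mul_gen_of_not_isRightDescent K cs h, map_mul, heckeChar_gen_of_mem K hi, mul_one]

/-- A right descent is absorbed, `π_w π_i = π_w`, so the character cannot vanish at `π_i`. -/
theorem mem_of_heckeChar_ne_zero_of_isRightDescent {C : Set B} {w : W} {i : B}
    (h : heckeChar K C (heckeElt K cs w) ≠ 0) (hi : cs.IsRightDescent w i) : i ∈ C := by
  by_contra hC
  apply h
  rw [← rightStep_of_isRightDescent cs hi, ← heckeElt_mul_gen, map_mul,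
    heckeChar_gen_of_notMem K hC, mul_zero]

/-- An element of the parabolic subgroup of `C` is an initial segment of every element that has all
of `C` as left descents. -/
theorem exists_eq_mul_of_left {C : Set B} {x y : W} (hx : heckeChar K C (heckeElt K cs x) ≠ 0)
    (hy : ∀ i ∈ C, cs.IsLeftDescent y i) :
    ∃ b, y = x * b ∧ cs.length y = cs.length x + cs.length b := by
  obtain ⟨ω, hω, rfl⟩ := cs.exists_isReduced x
  rw [← prod_map_gen K cs hω] at hx
  exact exists_eq_wordProd_mul cs hω fun i hi => hy i (heckeChar_prod_ne_zero K hx i hi)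

theorem heckeChar_inv {C : Set B} {x : W} (hx : heckeChar K C (heckeElt K cs x) ≠ 0) :
    heckeChar K C (heckeElt K cs x⁻¹) ≠ 0 := by
  obtain ⟨ω, hω, rfl⟩ := cs.exists_isReduced x
  rw [← prod_map_gen K cs hω, map_list_prod] at hx
  have h := prod_map_gen K cs hω.reverse
  rw [cs.wordProd_reverse] at h
  rwa [← h, map_list_prod, List.map_reverse, List.map_reverse, List.prod_reverse]

/-- Inversion turns this into the statement on initial segments. It is what makes `u_I` the least
element above, and later what bounds the support of a functional on `P_I^J`. -/
theorem leftWeakLE_of_heckeChar_ne_zero {C : Set B} {x y : W}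
    (hx : heckeChar K C (heckeElt K cs x) ≠ 0) (hy : ∀ i ∈ C, cs.IsRightDescent y i) :
    LeftWeakLE cs x y := by
  obtain ⟨b, h1, h2⟩ := exists_eq_mul_of_left K cs (heckeChar_inv K cs hx) (y := y⁻¹)
    (fun i hi => by rw [cs.isLeftDescent_inv_iff]; exact hy i hi)
  rw [leftWeakLE_iff]
  refine ⟨b⁻¹, ?_, ?_⟩
  · rw [← inv_inj, h1]; group
  · rw [← cs.length_inv, h2, cs.length_inv, cs.length_inv, add_comm]

end HeckeBasis

section DescentClasses

variable {B W : Type*} [Group W] {M : CoxeterMatrix B} (K : Type*) [Field K]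
  (cs : CoxeterSystem M W)

/-! ### Descent classes are intervals -/

theorem leftWeakLE_iff_length {u v : W} :
    LeftWeakLE cs u v ↔ cs.length v = cs.length (v * u⁻¹) + cs.length u := by
  rw [leftWeakLE_iff]
  constructor
  · rintro ⟨z, rfl, h⟩
    rwa [mul_inv_cancel_right]
  · intro h
    exact ⟨v * u⁻¹, by group, h⟩

theorem LeftWeakLE.length_le {u v : W} (h : LeftWeakLE cs u v) : cs.length u ≤ cs.length v := by
  obtain ⟨ω, -, h⟩ := h
  omega

theorem LeftWeakLE.eq_of_length_le {u v : W} (h : LeftWeakLE cs u v)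
    (h' : cs.length v ≤ cs.length u) : u = v := by
  obtain ⟨ω, rfl, h⟩ := h
  have : ω = [] := by rw [← List.length_eq_zero_iff]; omega
  subst this
  simp

theorem LeftWeakLE.antisymm {u v : W} (h : LeftWeakLE cs u v) (h' : LeftWeakLE cs v u) : u = v :=
  h.eq_of_length_le cs (h'.length_le cs)

theorem LeftWeakLE.rightDescentSet_subset {u v : W} (h : LeftWeakLE cs u v) :
    rightDescentSet cs u ⊆ rightDescentSet cs v := by
  obtain ⟨z, rfl, h⟩ := (leftWeakLE_iff cs).mp h
  intro i hi
  change cs.length (u * cs.simple i) < cs.length u at hi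
  change cs.length (z * u * cs.simple i) < cs.length (z * u)
  rw [mul_assoc]
  have := cs.length_mul_le z (u * cs.simple i)
  omega

variable [Finite W]

/-- An element of maximal length in the parabolic subgroup will do: a missing descent in `C` would
give a longer one. -/
theorem exists_parabolic_longest (C : Set B) : ∃ u, heckeChar K C (heckeElt K cs u) ≠ 0 ∧
    (∀ i ∈ C, cs.IsLeftDescent u i) ∧ ∀ i ∈ C, cs.IsRightDescent u i := by
  obtain ⟨u, hu, hmax⟩ := (Set.toFinite {w | heckeChar K C (heckeElt K cs w) ≠ 0}).exists_maximalFor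
    cs.length _ ⟨1, by simp [heckeElt_one]⟩
  refine ⟨u, hu, fun i hi => ?_, fun i hi => ?_⟩
  · by_contra h
    have h1 := hmax (j := cs.simple i * u) (by
      change heckeChar K C (heckeElt K cs _) ≠ 0
      rwa [heckeChar_simple_mul K cs hi])
    rw [not_isLeftDescent_iff] at h
    have := h1 (by omega)
    omega
  · by_contra h
    have h1 := hmax (j := u * cs.simple i) (by
      change heckeChar K C (heckeElt K cs _) ≠ 0
      rwa [heckeChar_mul_simple K cs hi h])
    rw [not_isRightDescent_iff] at h
    have := h1 (by omega)
    omega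

/-- The longest element of the parabolic subgroup belongs to the descent class and lies below all of
it, so it is the only element of minimal length there. -/
theorem shortestElt_spec (C : Set B) : heckeChar K C (heckeElt K cs (shortestElt cs C)) ≠ 0 ∧
    (∀ i ∈ C, cs.IsLeftDescent (shortestElt cs C) i) ∧
      ∀ i ∈ C, cs.IsRightDescent (shortestElt cs C) i := by
  obtain ⟨u, hu, hl, hr⟩ := exists_parabolic_longest K cs C
  have hmem : u ∈ descentClass cs C :=
    Set.Subset.antisymm (fun i hi => mem_of_heckeChar_ne_zero_of_isRightDescent K cs hu hi) hr
  have hmin : ∀ w ∈ descentClass cs C, LeftWeakLE cs u w := fun w hw =>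
    leftWeakLE_of_heckeChar_ne_zero K cs hu fun i hi => by
      change rightDescentSet cs w = C at hw
      rw [← hw] at hi; exact hi
  have hs : shortestElt cs C ∈ descentClass cs C ∧
      ∀ w ∈ descentClass cs C, cs.length (shortestElt cs C) ≤ cs.length w :=
    Classical.epsilon_spec (p := fun u => u ∈ descentClass cs C ∧
      ∀ w ∈ descentClass cs C, cs.length u ≤ cs.length w)
      ⟨u, hmem, fun w hw => (hmin w hw).length_le cs⟩
  rw [← (hmin _ hs.1).eq_of_length_le cs (hs.2 u hmem)]
  exact ⟨hu, hl, hr⟩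

theorem heckeChar_shortestElt (C : Set B) :
    heckeChar K C (heckeElt K cs (shortestElt cs C)) = 1 :=
  (heckeChar_heckeElt_eq_zero_or_one K cs C _).resolve_left (shortestElt_spec K cs C).1

theorem isLeftDescent_shortestElt {C : Set B} {i : B} (hi : i ∈ C) :
    cs.IsLeftDescent (shortestElt cs C) i :=
  -- The field only serves to express membership in a parabolic subgroup; any field would do.
  (shortestElt_spec ℚ cs C).2.1 i hi

theorem rightDescentSet_shortestElt (C : Set B) :
    rightDescentSet cs (shortestElt cs C) = C :=
  Set.Subset.antisymm (fun _ hi =>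
    mem_of_heckeChar_ne_zero_of_isRightDescent ℚ cs (shortestElt_spec ℚ cs C).1 hi)
    (shortestElt_spec ℚ cs C).2.2

theorem shortestElt_le_iff {I : Set B} {w : W} :
    LeftWeakLE cs (shortestElt cs I) w ↔ I ⊆ rightDescentSet cs w := by
  constructor
  · intro h
    have := h.rightDescentSet_subset cs
    rwa [rightDescentSet_shortestElt] at this
  · intro h
    exact leftWeakLE_of_heckeChar_ne_zero ℚ cs (shortestElt_spec ℚ cs I).1 fun i hi => h hi

/-! ### The longest element and the duality of descent classes -/

/-- The longest element of the group. -/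
noncomputable def longest : W := shortestElt cs Set.univ

theorem le_longest (w : W) : LeftWeakLE cs w (longest cs) := by
  refine leftWeakLE_of_heckeChar_ne_zero ℚ cs (C := Set.univ) ?_
    (shortestElt_spec ℚ cs Set.univ).2.2
  rw [heckeElt, map_list_prod, List.map_map]
  apply List.prod_ne_zero
  simp [heckeChar_gen_of_mem]

theorem length_longest_mul (w : W) :
    cs.length (longest cs * w) + cs.length w = cs.length (longest cs) := by
  have := (leftWeakLE_iff_length cs).mp (le_longest cs w⁻¹)
  rw [inv_inv, cs.length_inv] at this
  exact this.symm

theorem longest_mul_self : longest cs * longest cs = 1 := by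
  have := length_longest_mul cs (longest cs)
  rw [← cs.length_eq_zero_iff]
  omega

theorem longest_mul_longest_mul (w : W) : longest cs * (longest cs * w) = w := by
  rw [← mul_assoc, longest_mul_self, one_mul]

theorem length_longest_conj (w : W) :
    cs.length (longest cs * (w * longest cs)) = cs.length w := by
  have h1 := length_longest_mul cs (w * longest cs)
  have h2 := length_longest_mul cs w⁻¹
  have e : (w * longest cs)⁻¹ = longest cs * w⁻¹ := by
    rw [mul_inv_rev, inv_eq_of_mul_eq_one_left (longest_mul_self cs)]
  rw [← e, cs.length_inv, cs.length_inv] at h2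
  omega

/-- Left multiplication by the longest element complements lengths and conjugation by it preserves
them, so the order is reversed. Facts on `v_J` thereby follow from those on `u_I` for the
complementary set. -/
theorem LeftWeakLE.longest_mul {u v : W} (h : LeftWeakLE cs u v) :
    LeftWeakLE cs (longest cs * v) (longest cs * u) := by
  have h1 := length_longest_mul cs u
  have h2 := length_longest_mul cs v
  rw [leftWeakLE_iff_length] at h ⊢
  have e : longest cs * u * (longest cs * v)⁻¹ = longest cs * ((v * u⁻¹)⁻¹ * longest cs) := by
    rw [mul_inv_rev, inv_eq_of_mul_eq_one_left (longest_mul_self cs)]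
    group
  rw [e, length_longest_conj, cs.length_inv]
  omega

theorem rightDescentSet_longest_mul (w : W) :
    rightDescentSet cs (longest cs * w) = (rightDescentSet cs w)ᶜ := by
  ext i
  change cs.length (longest cs * w * cs.simple i) < cs.length (longest cs * w) ↔
    ¬ cs.length (w * cs.simple i) < cs.length w
  have h1 := length_longest_mul cs w
  have h2 := length_longest_mul cs (w * cs.simple i)
  have h3 := cs.length_mul_simple_ne w i
  rw [mul_assoc]
  omega

theorem longestElt_eq (J : Set B) : longestElt cs J = longest cs * shortestElt cs Jᶜ := by
  set v := longest cs * shortestElt cs Jᶜ with hv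
  have hmem : v ∈ descentClass cs J := by
    change rightDescentSet cs v = J
    rw [hv, rightDescentSet_longest_mul, rightDescentSet_shortestElt, compl_compl]
  have hmax : ∀ w ∈ descentClass cs J, LeftWeakLE cs w v := by
    intro w hw
    change rightDescentSet cs w = J at hw
    have : LeftWeakLE cs (shortestElt cs Jᶜ) (longest cs * w) := by
      rw [shortestElt_le_iff, rightDescentSet_longest_mul, hw]
    simpa only [longest_mul_longest_mul] using this.longest_mul cs
  have hs : longestElt cs J ∈ descentClass cs J ∧
      ∀ w ∈ descentClass cs J, cs.length w ≤ cs.length (longestElt cs J) :=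
    Classical.epsilon_spec (p := fun v => v ∈ descentClass cs J ∧
      ∀ w ∈ descentClass cs J, cs.length w ≤ cs.length v)
      ⟨v, hmem, fun w hw => (hmax w hw).length_le cs⟩
  exact (hmax _ hs.1).eq_of_length_le cs (hs.2 v hmem)

theorem rightDescentSet_longestElt (J : Set B) : rightDescentSet cs (longestElt cs J) = J := by
  rw [longestElt_eq, rightDescentSet_longest_mul, rightDescentSet_shortestElt, compl_compl]

theorem le_longestElt_iff {J : Set B} {w : W} :
    LeftWeakLE cs w (longestElt cs J) ↔ rightDescentSet cs w ⊆ J := by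
  constructor
  · intro h
    have := h.rightDescentSet_subset cs
    rwa [rightDescentSet_longestElt] at this
  · intro h
    have : LeftWeakLE cs (shortestElt cs Jᶜ) (longest cs * w) := by
      rw [shortestElt_le_iff, rightDescentSet_longest_mul]
      exact Set.compl_subset_compl.mpr h
    rw [longestElt_eq]
    simpa only [longest_mul_longest_mul] using this.longest_mul cs

theorem mem_leftInterval_iff {I J : Set B} {w : W} :
    w ∈ leftInterval cs (shortestElt cs I) (longestElt cs J) ↔
      I ⊆ rightDescentSet cs w ∧ rightDescentSet cs w ⊆ J :=
  and_congr (shortestElt_le_iff cs) (le_longestElt_iff cs)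

theorem shortestElt_mem_leftInterval {I J : Set B} (h : I ⊆ J) :
    shortestElt cs I ∈ leftInterval cs (shortestElt cs I) (longestElt cs J) := by
  rw [mem_leftInterval_iff, rightDescentSet_shortestElt]
  exact ⟨Set.Subset.rfl, h⟩

end DescentClasses

section IntervalModules

variable {B W : Type*} [Group W] {M : CoxeterMatrix B} (K : Type*) [Field K]
  (cs : CoxeterSystem M W)

/-! ### Computing in interval modules -/

instance (u v : W) : IsScalarTower K (HeckeAlgebra M K) (IntervalModule cs K u v) :=
  IsScalarTower.of_algebraMap_smul fun a x => algebraMap_smul cs K u v a x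

open Classical in
/-- The vector of `B(u, v)` given by an element of `W`; it is zero outside of the interval. -/
noncomputable def intervalVec (u v x : W) : IntervalModule cs K u v :=
  if h : x ∈ leftInterval cs u v then IntervalModule.of cs K ⟨x, h⟩ else 0

theorem intervalVec_coe {u v : W} (x : leftInterval cs u v) :
    intervalVec K cs u v x = IntervalModule.of cs K x := by
  rw [intervalVec, dif_pos x.2]

theorem intervalVec_of_notMem {u v x : W} (h : x ∉ leftInterval cs u v) :
    intervalVec K cs u v x = 0 := by
  rw [intervalVec, dif_neg h]

theorem basis_eq_intervalVec {u v : W} (x : leftInterval cs u v) :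
    IntervalModule.basis cs K u v x = intervalVec K cs u v x := by
  rw [intervalVec_coe, IntervalModule.basis_apply]

theorem intervalVec_ne_zero {u v x : W} (h : x ∈ leftInterval cs u v) :
    intervalVec K cs u v x ≠ 0 := by
  rw [← basis_eq_intervalVec K cs ⟨x, h⟩]
  exact (IntervalModule.basis cs K u v).ne_zero _

/-- With the value zero outside of the interval, the three cases of the action become one. The
hypothesis ensures that an outside element fails to be below `v`, so that no step leads back in. -/
theorem gen_smul_intervalVec {u v x : W} (hx : LeftWeakLE cs u x) (i : B) :
    HeckeAlgebra.gen M K i • intervalVec K cs u v x = intervalVec K cs u v (step cs i x) := by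
  by_cases h : x ∈ leftInterval cs u v
  · rw [intervalVec, dif_pos h, gen_smul_of, intervalVec]
    by_cases h1 : cs.IsLeftDescent x i
    · rw [step_of_isLeftDescent cs h1, if_pos h1, dif_pos h]
    · rw [step_of_not_isLeftDescent cs h1, if_neg h1]
  · rw [intervalVec_of_notMem K cs h, smul_zero, intervalVec_of_notMem]
    exact fun h' => h ⟨hx, (LeftWeakLE.step cs i x).trans cs h'.2⟩

theorem prod_smul_intervalVec {u v x : W} (hx : LeftWeakLE cs u x) (ω : List B) :
    (ω.map (HeckeAlgebra.gen M K)).prod • intervalVec K cs u v x =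
      intervalVec K cs u v (act cs ω x) := by
  induction ω with
  | nil => simp [act]
  | cons i ω ih =>
    rw [List.map_cons, List.prod_cons, mul_smul, ih, gen_smul_intervalVec, act]
    exact hx.trans cs (LeftWeakLE.act cs ω x)

/-- A linear map out of `B(u, v)` that is compatible with the generators on the basis is a module
homomorphism. -/
theorem intervalModule_map_gen_smul {u v : W} {N : Type*} [AddCommGroup N] [Module K N]
    [Module (HeckeAlgebra M K) N] [IsScalarTower K (HeckeAlgebra M K) N]
    (f : IntervalModule cs K u v →ₗ[K] N)
    (hf : ∀ i, ∀ x ∈ leftInterval cs u v, f (intervalVec K cs u v (step cs i x)) =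
      HeckeAlgebra.gen M K i • f (intervalVec K cs u v x)) (i : B) (p : IntervalModule cs K u v) :
    f (HeckeAlgebra.gen M K i • p) = HeckeAlgebra.gen M K i • f p := by
  have : f ∘ₗ DistribSMul.toLinearMap K (IntervalModule cs K u v) (HeckeAlgebra.gen M K i) =
      DistribSMul.toLinearMap K N (HeckeAlgebra.gen M K i) ∘ₗ f := by
    apply (IntervalModule.basis cs K u v).ext
    intro x
    simp only [LinearMap.comp_apply, DistribSMul.toLinearMap_apply]
    rw [basis_eq_intervalVec, gen_smul_intervalVec K cs x.2.1, hf i x x.2]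
  exact LinearMap.congr_fun this p

theorem constr_intervalVec {u v : W} {N : Type*} [AddCommGroup N] [Module K N] (f : W → N) {x : W}
    (hx : x ∈ leftInterval cs u v) :
    (IntervalModule.basis cs K u v).constr K (fun y => f y) (intervalVec K cs u v x) = f x := by
  rw [← basis_eq_intervalVec K cs ⟨x, hx⟩, Module.Basis.constr_basis]

/-- Both sides are the Demazure product of the two words, computed from the left and from the right.
-/
theorem act_eq_rightAct {ω τ : List B} (hω : cs.IsReduced ω) (hτ : cs.IsReduced τ) :
    act cs ω (cs.wordProd τ) = rightAct cs τ (cs.wordProd ω) := by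
  have : rightAct cs τ 1 = cs.wordProd τ := by
    rw [rightAct_of_isReduced, one_mul]
    rw [one_mul, cs.length_one, zero_add]; exact hτ
  rw [← this, act_rightAct, act_one_of_isReduced cs hω]

theorem rightAct_eq_self {τ : List B} {w : W} (h : ∀ i ∈ τ, cs.IsRightDescent w i) :
    rightAct cs τ w = w := by
  induction τ with
  | nil => rfl
  | cons i τ ih =>
    rw [rightAct, rightStep_of_isRightDescent cs (h i List.mem_cons_self)]
    exact ih fun j hj => h j (List.mem_cons_of_mem _ hj)

theorem length_le_rightAct (τ : List B) (w : W) :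
    cs.length w ≤ cs.length (rightAct cs τ w) := by
  obtain ⟨b, h1, h2⟩ := exists_rightAct cs τ w
  rw [h1]; omega

theorem LeftWeakLE.refl (w : W) : LeftWeakLE cs w w := ⟨[], by simp⟩

variable [Finite W]

theorem heckeElt_smul_intervalVec {u v : W} {τ : List B} (hτ : cs.IsReduced τ)
    (h : LeftWeakLE cs u (cs.wordProd τ)) (w : W) :
    heckeElt K cs w • intervalVec K cs u v (cs.wordProd τ) =
      intervalVec K cs u v (rightAct cs τ w) := by
  obtain ⟨ω, hω, rfl⟩ := cs.exists_isReduced w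
  rw [← prod_map_gen K cs hω, prod_smul_intervalVec K cs h, act_eq_rightAct cs hω hτ]

theorem exists_word_shortestElt (I : Set B) : ∃ τ, cs.IsReduced τ ∧
    shortestElt cs I = cs.wordProd τ ∧ ∀ i ∈ τ, i ∈ I := by
  obtain ⟨τ, hτ, e⟩ := cs.exists_isReduced (shortestElt cs I)
  refine ⟨τ, hτ, e, ?_⟩
  apply heckeChar_prod_ne_zero ℚ (M := M)
  rw [prod_map_gen ℚ cs hτ, ← e]
  exact (shortestElt_spec ℚ cs I).1

/-- `B(u_I, v)` is generated by `u_I`. -/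
theorem heckeElt_smul_shortestElt {I : Set B} {v w : W} (h : I ⊆ rightDescentSet cs w) :
    heckeElt K cs w • intervalVec K cs (shortestElt cs I) v (shortestElt cs I) =
      intervalVec K cs (shortestElt cs I) v w := by
  obtain ⟨τ, hτ, e, hI⟩ := exists_word_shortestElt cs I
  have := heckeElt_smul_intervalVec K cs (u := shortestElt cs I) (v := v) hτ
    (e ▸ LeftWeakLE.refl cs _) w
  -- The letters of `u_I` lie in `I`, hence are right descents of `w` and leave it fixed.
  rwa [rightAct_eq_self cs fun i hi => h (hI i hi), ← e] at this

/-! ### The projective modules `P_X` -/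

/-- The alternating sum of the elements `π_z` over the parabolic subgroup of `Y`. -/
noncomputable def altSum (Y : Set B) : HeckeAlgebra M K :=
  letI := Fintype.ofFinite W
  ∑ z : W, ((-1) ^ cs.length z * heckeChar K Y (heckeElt K cs z)) • heckeElt K cs z

/-- The terms of `z` and `s_i z` cancel: multiplication by `π_i` sends both to the same element, and
their signs are opposite. -/
theorem gen_mul_altSum {Y : Set B} {i : B} (hi : i ∈ Y) :
    HeckeAlgebra.gen M K i * altSum K cs Y = 0 := by
  classical
  let _ := Fintype.ofFinite W
  rw [altSum, Finset.mul_sum]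
  refine Finset.sum_involution (fun z _ => cs.simple i * z) ?_ ?_ (fun _ _ => Finset.mem_univ _)
    (fun z _ => cs.simple_mul_simple_cancel_left i)
  · intro z _
    have hstep : step cs i (cs.simple i * z) = step cs i z := by
      by_cases h : cs.IsLeftDescent z i
      · rw [step_of_isLeftDescent cs h, step_of_not_isLeftDescent cs
          (cs.isLeftDescent_iff_not_isLeftDescent_mul.mp h), cs.simple_mul_simple_cancel_left]
      · rw [step_of_not_isLeftDescent cs h, step_of_isLeftDescent]
        rw [cs.isLeftDescent_iff_not_isLeftDescent_mul, cs.simple_mul_simple_cancel_left]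
        exact h
    have hsign : (-1 : K) ^ cs.length (cs.simple i * z) = - (-1) ^ cs.length z := by
      rcases cs.length_simple_mul z i with h | h
      · rw [h, pow_succ]; ring
      · rw [← h, pow_succ]; ring
    rw [mul_smul_comm, mul_smul_comm, gen_mul_heckeElt, gen_mul_heckeElt, hstep,
      heckeChar_simple_mul K cs hi, hsign, ← add_smul]
    ring_nf
    exact zero_smul K _
  · intro z _ _ h
    exact cs.length_simple_mul_ne z i (by rw [h])

/-- The homomorphism from `P_X` that sends `w` to `π_w θ n`, with `θ` the alternating sum over the
parabolic subgroup of the complement of `X`. -/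
noncomputable def projMap (X : Set B) {N : Type*} [AddCommGroup N] [Module K N]
    [Module (HeckeAlgebra M K) N] [IsScalarTower K (HeckeAlgebra M K) N] (n : N) :
    ProjModule cs K X X →ₗ[HeckeAlgebra M K] N :=
  heckeLinearMap K ((IntervalModule.basis cs K _ _).constr K fun w =>
    (heckeElt K cs (w : W) * altSum K cs Xᶜ) • n) (by
      apply intervalModule_map_gen_smul
      intro i x hx
      rw [constr_intervalVec K cs (fun w => (heckeElt K cs w * altSum K cs Xᶜ) • n) hx,
        ← mul_smul, ← mul_assoc, gen_mul_heckeElt]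
      by_cases h : step cs i x ∈ leftInterval cs (shortestElt cs X) (longestElt cs X)
      · exact constr_intervalVec K cs (fun w => (heckeElt K cs w * altSum K cs Xᶜ) • n) h
      -- Leaving the interval means to gain a right descent `t ∉ X`. Then `π_t` can be split off on
      -- the right, and it kills the alternating sum.
      · rw [intervalVec_of_notMem K cs h, map_zero]
        have hx' : X ⊆ rightDescentSet cs (step cs i x) := by
          rw [← shortestElt_le_iff]
          exact hx.1.trans cs (LeftWeakLE.step cs i x)
        obtain ⟨t, ht, htX⟩ : ∃ t ∈ rightDescentSet cs (step cs i x), t ∉ X := by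
          rw [← Set.not_subset]
          exact fun h' => h ((mem_leftInterval_iff cs).mpr ⟨hx', h'⟩)
        rw [← rightStep_of_isRightDescent cs ht, ← heckeElt_mul_gen, mul_assoc,
          gen_mul_altSum K cs htX, mul_zero, zero_smul])

theorem projMap_intervalVec {X : Set B} {N : Type*} [AddCommGroup N] [Module K N]
    [Module (HeckeAlgebra M K) N] [IsScalarTower K (HeckeAlgebra M K) N] (n : N) {w : W}
    (hw : rightDescentSet cs w = X) :
    projMap K cs X n (intervalVec K cs _ _ w) = (heckeElt K cs w * altSum K cs Xᶜ) • n :=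
  constr_intervalVec K cs (fun w => (heckeElt K cs w * altSum K cs Xᶜ) • n)
    ((mem_leftInterval_iff cs).mpr ⟨hw.symm.subset, hw.subset⟩)

/-- The leading term of the image of `w` under `projMap`. -/
theorem intervalVec_mem_of_projMap_mem {I : Set B} {v w : W} (hw : I ⊆ rightDescentSet cs w)
    {R : Submodule K (IntervalModule cs K (shortestElt cs I) v)}
    (h : (heckeElt K cs w * altSum K cs (rightDescentSet cs w)ᶜ) •
      intervalVec K cs (shortestElt cs I) v (shortestElt cs I) ∈ R)
    (hR : ∀ y, cs.length w < cs.length y → intervalVec K cs (shortestElt cs I) v y ∈ R) :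
    intervalVec K cs (shortestElt cs I) v w ∈ R := by
  classical
  let _ := Fintype.ofFinite W
  obtain ⟨σ, hσ, e, -⟩ := exists_word_shortestElt cs I
  -- The term `z = 1` contributes `w` itself. Any other relevant `z` begins with a letter that is
  -- not a right descent of `w`, so it contributes a multiple of something longer.
  rw [altSum, Finset.mul_sum, Finset.sum_smul, ← Finset.add_sum_erase _ _ (Finset.mem_univ 1)] at h
  rw [cs.length_one, heckeElt_one, map_one, pow_zero, one_mul, one_smul, mul_one,
    heckeElt_smul_shortestElt K cs hw] at h
  refine (Submodule.add_mem_iff_left R (Submodule.sum_mem R fun z hz => ?_)).mp h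
  rw [mul_smul_comm, smul_assoc]
  by_cases hz0 : heckeChar K (rightDescentSet cs w)ᶜ (heckeElt K cs z) = 0
  · rw [hz0, mul_zero, zero_smul]; exact R.zero_mem
  apply R.smul_mem
  obtain ⟨τ, hτ, rfl⟩ := cs.exists_isReduced z
  rw [← prod_map_gen K cs hτ, heckeElt_mul_prod]
  have h2 := heckeElt_smul_intervalVec K cs (u := shortestElt cs I) (v := v) hσ
    (e ▸ LeftWeakLE.refl cs _) (rightAct cs τ w)
  rw [← e] at h2
  rw [h2]
  apply hR
  refine lt_of_lt_of_le ?_ (length_le_rightAct cs _ _)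
  rw [← prod_map_gen K cs hτ] at hz0
  cases τ with
  | nil => simp at hz
  | cons t τ =>
    have ht : ¬ cs.IsRightDescent w t := heckeChar_prod_ne_zero K hz0 t List.mem_cons_self
    refine lt_of_lt_of_le ?_ (length_le_rightAct cs τ (rightStep cs t w))
    rw [rightStep_of_not_isRightDescent cs ht]
    rw [not_isRightDescent_iff] at ht
    omega

end IntervalModules

section MainResults

variable {B W : Type*} [Group W] {M : CoxeterMatrix B} (K : Type*) [Field K]
  (cs : CoxeterSystem M W)

/-! ### Projections between interval modules -/

/-- The projection of `P_I^J` onto `B(u_I, w)`. -/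
noncomputable def intervalProj (u v w : W) (h : LeftWeakLE cs w v) :
    IntervalModule cs K u v →ₗ[HeckeAlgebra M K] IntervalModule cs K u w :=
  heckeLinearMap K ((IntervalModule.basis cs K u v).constr K fun x => intervalVec K cs u w x) (by
    have hf : ∀ x, LeftWeakLE cs u x → (IntervalModule.basis cs K u v).constr K
        (fun x => intervalVec K cs u w x) (intervalVec K cs u v x) = intervalVec K cs u w x := by
      intro x hx
      by_cases hxv : x ∈ leftInterval cs u v
      · exact constr_intervalVec K cs (intervalVec K cs u w) hxv
      · rw [intervalVec_of_notMem K cs hxv, map_zero, intervalVec_of_notMem]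
        exact fun h' => hxv ⟨hx, h'.2.trans cs h⟩
    apply intervalModule_map_gen_smul
    intro i x hx
    rw [hf _ (hx.1.trans cs (LeftWeakLE.step cs i x)), hf _ hx.1, gen_smul_intervalVec K cs hx.1])

theorem intervalProj_intervalVec {u v w : W} (h : LeftWeakLE cs w v) {x : W}
    (hx : x ∈ leftInterval cs u v) :
    intervalProj K cs u v w h (intervalVec K cs u v x) = intervalVec K cs u w x :=
  constr_intervalVec K cs (intervalVec K cs u w) hx

theorem intervalProj_surjective {u v w : W} (h : LeftWeakLE cs w v) :
    Function.Surjective (intervalProj K cs u v w h) := by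
  suffices H : (⊤ : Submodule K (IntervalModule cs K u w)) ≤
      LinearMap.range ((intervalProj K cs u v w h).restrictScalars K) from
    fun y => H (Submodule.mem_top (x := y))
  rw [← (IntervalModule.basis cs K u w).span_eq, Submodule.span_le]
  rintro _ ⟨x, rfl⟩
  rw [basis_eq_intervalVec]
  exact ⟨intervalVec K cs u v x, intervalProj_intervalVec K cs h ⟨x.2.1, x.2.2.trans cs h⟩⟩

/-- A functional that kills the basis elements outside of `[u, w]` kills the kernel of the
projection. -/
theorem functional_eq_zero_of_mem_ker {u v w : W} (h : LeftWeakLE cs w v)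
    {φ : IntervalModule cs K u v →ₗ[K] K}
    (hφ : ∀ x ∈ leftInterval cs u v, ¬ LeftWeakLE cs x w → φ (intervalVec K cs u v x) = 0)
    {p : IntervalModule cs K u v} (hp : intervalProj K cs u v w h p = 0) : φ p = 0 := by
  let ψ : IntervalModule cs K u w →ₗ[K] K := (IntervalModule.basis cs K u w).constr K
    fun x => φ (intervalVec K cs u v x)
  have : φ = ψ ∘ₗ (intervalProj K cs u v w h).restrictScalars K := by
    apply (IntervalModule.basis cs K u v).ext
    intro x
    rw [basis_eq_intervalVec, LinearMap.comp_apply, LinearMap.restrictScalars_apply,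
      intervalProj_intervalVec K cs h x.2]
    by_cases hx : LeftWeakLE cs x w
    · exact (constr_intervalVec K cs (fun x => φ (intervalVec K cs u v x)) ⟨x.2.1, hx⟩).symm
    · rw [hφ x x.2 hx, intervalVec_of_notMem K cs fun h' => hx h'.2, map_zero]
  rw [this, LinearMap.comp_apply, LinearMap.restrictScalars_apply, hp, map_zero]

theorem sup_ne_top_of_functional {I J : Set B} {φ : ProjModule cs K I J →ₗ[K] K} (hφ : φ ≠ 0)
    {N L : Submodule (HeckeAlgebra M K) (ProjModule cs K I J)} (hN : ∀ x ∈ N, φ x = 0)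
    (hL : ∀ x ∈ L, φ x = 0) : N ⊔ L ≠ ⊤ := by
  intro h
  apply hφ
  ext x
  obtain ⟨y, hy, z, hz, rfl⟩ := Submodule.mem_sup.mp (h ▸ Submodule.mem_top (x := x))
  rw [map_add, hN y hy, hL z hz, add_zero, LinearMap.zero_apply]

variable [Finite W]

/-! ### The decomposition of `P_I^J` -/

instance (u v : W) : FiniteDimensional K (IntervalModule cs K u v) :=
  Module.Basis.finiteDimensional_of_finite (IntervalModule.basis cs K u v)

/-- The direct sum of the modules `P_X` for `I ⊆ X ⊆ J`. -/
abbrev ProjSum (I J : Set B) : Type _ :=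
  DirectSum {X : Set B // I ⊆ X ∧ X ⊆ J} fun X => ProjModule cs K X.1 X.1

open Classical in
/-- The homomorphism from the sum of the modules `P_X`, for `I ⊆ X ⊆ J`, to `P_I^J`. -/
noncomputable def sumMap (I J : Set B) : ProjSum K cs I J →ₗ[HeckeAlgebra M K] ProjModule cs K I J :=
  DirectSum.toModule (HeckeAlgebra M K) _ _ fun X =>
    projMap K cs X.1 (intervalVec K cs _ _ (shortestElt cs I))

open Classical in
/-- The linear map from `P_I^J` to the sum of the modules `P_X` that distributes the elements of
the interval over the descent classes. -/
noncomputable def distribute (I J : Set B) : ProjModule cs K I J →ₗ[K] ProjSum K cs I J :=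
  (IntervalModule.basis cs K _ _).constr K fun w =>
    DirectSum.lof K {X : Set B // I ⊆ X ∧ X ⊆ J} (fun X => ProjModule cs K X.1 X.1)
      ⟨rightDescentSet cs w.1, (mem_leftInterval_iff cs).mp w.2⟩ (intervalVec K cs _ _ w.1)

open Classical in
theorem distribute_intervalVec {I J : Set B} {w : W}
    (hw : w ∈ leftInterval cs (shortestElt cs I) (longestElt cs J)) :
    distribute K cs I J (intervalVec K cs _ _ w) =
      DirectSum.lof K {X : Set B // I ⊆ X ∧ X ⊆ J} (fun X => ProjModule cs K X.1 X.1)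
        ⟨rightDescentSet cs w, (mem_leftInterval_iff cs).mp hw⟩ (intervalVec K cs _ _ w) := by
  rw [← basis_eq_intervalVec K cs ⟨w, hw⟩, distribute, Module.Basis.constr_basis]

theorem distribute_surjective (I J : Set B) : Function.Surjective (distribute K cs I J) := by
  classical
  rw [← LinearMap.range_eq_top, eq_top_iff]
  rintro x -
  induction x using DirectSum.induction_on with
  | zero => exact Submodule.zero_mem _
  | add x y hx hy => exact Submodule.add_mem _ hx hy
  | of X y =>
    have h : (⊤ : Submodule K (ProjModule cs K X.1 X.1)) ≤
        (LinearMap.range (distribute K cs I J)).comap (DirectSum.lof K _ _ X) := by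
      rw [← (IntervalModule.basis cs K _ _).span_eq, Submodule.span_le]
      rintro _ ⟨⟨w, hw⟩, rfl⟩
      obtain ⟨h1, h2⟩ := (mem_leftInterval_iff cs).mp hw
      obtain ⟨X, hX⟩ := X
      obtain rfl : rightDescentSet cs w = X := Set.Subset.antisymm h2 h1
      exact ⟨intervalVec K cs _ _ w, by
        rw [distribute_intervalVec K cs ((mem_leftInterval_iff cs).mpr hX), basis_eq_intervalVec]⟩
    exact h (Submodule.mem_top (x := y))

theorem sumMap_distribute {I J : Set B} {w : W}
    (hw : w ∈ leftInterval cs (shortestElt cs I) (longestElt cs J)) :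
    sumMap K cs I J (distribute K cs I J (intervalVec K cs _ _ w)) =
      (heckeElt K cs w * altSum K cs (rightDescentSet cs w)ᶜ) •
        intervalVec K cs _ _ (shortestElt cs I) := by
  classical
  rw [distribute_intervalVec K cs hw]
  exact (DirectSum.toModule_lof (HeckeAlgebra M K) _ _).trans (projMap_intervalVec K cs _ rfl)

/-- Composed with the redistribution of the basis, the map is unitriangular for the length.
Descending induction on the length gives surjectivity, finite dimension gives injectivity, and the
redistribution is onto. -/
theorem sumMap_bijective (I J : Set B) : Function.Bijective (sumMap K cs I J) := by
  set g : ProjModule cs K I J →ₗ[K] ProjModule cs K I J :=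
    (sumMap K cs I J).restrictScalars K ∘ₗ distribute K cs I J with hg
  have hsurj : Function.Surjective g := by
    have H : ∀ n, ∀ w, cs.length (longest cs) - cs.length w = n →
        intervalVec K cs _ _ w ∈ LinearMap.range g := by
      intro n
      induction n using Nat.strong_induction_on with
      | _ n ih =>
        intro w hn
        by_cases hw : w ∈ leftInterval cs (shortestElt cs I) (longestElt cs J)
        · refine intervalVec_mem_of_projMap_mem K cs ((mem_leftInterval_iff cs).mp hw).1
            ⟨intervalVec K cs _ _ w, sumMap_distribute K cs hw⟩ fun y hy => ?_
          have := (le_longest cs y).length_le cs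
          exact ih _ (by omega) y rfl
        · rw [intervalVec_of_notMem K cs hw]
          exact Submodule.zero_mem _
    rw [← LinearMap.range_eq_top, eq_top_iff, ← (IntervalModule.basis cs K _ _).span_eq,
      Submodule.span_le]
    rintro _ ⟨w, rfl⟩
    rw [basis_eq_intervalVec]
    exact H _ _ rfl
  have hinj : Function.Injective g := LinearMap.injective_iff_surjective.mpr hsurj
  constructor
  · intro x y hxy
    obtain ⟨x, rfl⟩ := distribute_surjective K cs I J x
    obtain ⟨y, rfl⟩ := distribute_surjective K cs I J y
    rw [hinj (show g x = g y from hxy)]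
  · intro y
    obtain ⟨x, hx⟩ := hsurj y
    exact ⟨_, hx⟩

/-- The decomposition of `P_I^J` as a sum of modules `P_X`. -/
noncomputable def sumEquiv (I J : Set B) :
    ProjSum K cs I J ≃ₗ[HeckeAlgebra M K] ProjModule cs K I J :=
  LinearEquiv.ofBijective (sumMap K cs I J) (sumMap_bijective K cs I J)

/-! ### Projectivity -/

/-- The map `w ↦ π_w` into the regular module is split by evaluation at `u_∅`. A retraction
suffices, so linear independence of the `π_w` is not needed separately. -/
theorem projective_empty_univ : Module.Projective (HeckeAlgebra M K)
    (ProjModule cs K (∅ : Set B) Set.univ) := by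
  have hmem : ∀ w, w ∈ leftInterval cs (shortestElt cs ∅) (longestElt cs Set.univ) := fun w =>
    (mem_leftInterval_iff cs).mpr ⟨Set.empty_subset _, Set.subset_univ _⟩
  let f := (IntervalModule.basis cs K (shortestElt cs ∅) (longestElt cs Set.univ)).constr K
    fun w => heckeElt K cs (w : W)
  have hf : ∀ w, f (intervalVec K cs _ _ w) = heckeElt K cs w := fun w =>
    constr_intervalVec K cs (heckeElt K cs) (hmem w)
  have hlin := intervalModule_map_gen_smul K cs f (fun i x _ => by
    rw [hf, hf, smul_eq_mul, gen_mul_heckeElt])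
  let g : HeckeAlgebra M K →ₗ[HeckeAlgebra M K] ProjModule cs K (∅ : Set B) Set.univ :=
    LinearMap.toSpanSingleton _ _ (intervalVec K cs _ _ (shortestElt cs ∅))
  refine Module.Projective.of_split (heckeLinearMap K f hlin) g ?_
  have : g.restrictScalars K ∘ₗ f = LinearMap.id := by
    apply (IntervalModule.basis cs K _ _).ext
    intro w
    rw [basis_eq_intervalVec, LinearMap.comp_apply, hf]
    exact heckeElt_smul_shortestElt K cs (Set.empty_subset _)
  ext x
  exact LinearMap.congr_fun this x

theorem projective_self (X : Set B) :
    Module.Projective (HeckeAlgebra M K) (ProjModule cs K X X) := by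
  classical
  have := projective_empty_univ K cs
  have h : Module.Projective (HeckeAlgebra M K) (ProjSum K cs ∅ Set.univ) :=
    Module.Projective.of_equiv (sumEquiv K cs ∅ Set.univ).symm
  let X' : {X : Set B // ∅ ⊆ X ∧ X ⊆ Set.univ} := ⟨X, Set.empty_subset _, Set.subset_univ _⟩
  exact Module.Projective.of_split
    (DirectSum.lof (HeckeAlgebra M K) {X : Set B // ∅ ⊆ X ∧ X ⊆ Set.univ}
      (fun X => ProjModule cs K X.1 X.1) X')
    (DirectSum.component (HeckeAlgebra M K) {X : Set B // ∅ ⊆ X ∧ X ⊆ Set.univ}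
      (fun X => ProjModule cs K X.1 X.1) X')
    (DirectSum.component_comp_lof_same _ X')

theorem projective_projModule (I J : Set B) :
    Module.Projective (HeckeAlgebra M K) (ProjModule cs K I J) := by
  have := projective_self K cs
  have h : Module.Projective (HeckeAlgebra M K) (ProjSum K cs I J) := by
    unfold ProjSum DirectSum
    infer_instance
  exact Module.Projective.of_equiv (sumEquiv K cs I J)

/-! ### The maximal submodules of `P_I^J` -/

/-- Start from any nonzero functional that kills `L` and compose it with `π_w`, for `w` as long as
possible with nonzero result. Now `π_w π_i` is `π_w` for a right descent, and otherwise belongs to a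
longer element, where the composite vanishes. So the generators act by the character of `D_R(w)`. -/
theorem exists_eigenfunctional (cs : CoxeterSystem M W) {N : Type*} [AddCommGroup N] [Module K N]
    [Module (HeckeAlgebra M K) N] [IsScalarTower K (HeckeAlgebra M K) N]
    {L : Submodule (HeckeAlgebra M K) N} (hL : L ≠ ⊤) :
    ∃ (C : Set B) (φ : N →ₗ[K] K), φ ≠ 0 ∧ (∀ x ∈ L, φ x = 0) ∧
      ∀ (h : HeckeAlgebra M K) x, φ (h • x) = heckeChar K C h * φ x := by
  have hL' : L.restrictScalars K < ⊤ := by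
    rw [lt_top_iff_ne_top]
    intro h
    exact hL ((Submodule.restrictScalars_eq_top_iff K _ _).mp h)
  obtain ⟨φ, hφ0, hφL⟩ := Submodule.exists_le_ker_of_lt_top _ hL'
  let ψ : W → N →ₗ[K] K := fun w => φ ∘ₗ DistribSMul.toLinearMap K N (heckeElt K cs w)
  have hψ : ∀ w x, ψ w x = φ (heckeElt K cs w • x) := fun _ _ => rfl
  obtain ⟨w, hw, hmax⟩ := (Set.toFinite {w | ψ w ≠ 0}).exists_maximalFor cs.length _ ⟨1, by
    change ψ 1 ≠ 0
    have : ψ 1 = φ := LinearMap.ext fun x => by rw [hψ, heckeElt_one, one_smul]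
    rwa [this]⟩
  refine ⟨rightDescentSet cs w, ψ w, hw, fun x hx => hφL (L.smul_mem _ hx), fun h => ?_⟩
  induction h using heckeAlgebra_induction with
  | algebraMap a => intro x; simp
  | gen i =>
    intro x
    rw [hψ, ← mul_smul, heckeElt_mul_gen, ← hψ]
    by_cases hi : cs.IsRightDescent w i
    · rw [heckeChar_gen_of_mem K (C := rightDescentSet cs w) hi, one_mul, rightStep_of_isRightDescent cs hi]
    · rw [heckeChar_gen_of_notMem K (C := rightDescentSet cs w) hi, zero_mul,
        rightStep_of_not_isRightDescent cs hi]
      have h0 : ψ (w * cs.simple i) = 0 := by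
        by_contra h
        have := hmax h
        rw [not_isRightDescent_iff] at hi
        have := this (by omega)
        omega
      rw [h0, LinearMap.zero_apply]
  | add h h' ih ih' => intro x; rw [add_smul, map_add, ih, ih', map_add, add_mul]
  | mul h h' ih ih' => intro x; rw [mul_smul, ih, ih', map_mul, mul_assoc]

/-- Every proper submodule of `P_I^J` is in the kernel of a character of `P_I^J`. -/
theorem exists_functional_of_ne_top {I J : Set B}
    {L : Submodule (HeckeAlgebra M K) (ProjModule cs K I J)} (hL : L ≠ ⊤) :
    ∃ (C : Set B) (φ : ProjModule cs K I J →ₗ[K] K), I ⊆ C ∧ C ⊆ J ∧ (∀ x ∈ L, φ x = 0) ∧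
      ∀ w ∈ leftInterval cs (shortestElt cs I) (longestElt cs J),
        φ (intervalVec K cs _ _ w) = heckeChar K C (heckeElt K cs w) := by
  obtain ⟨C, φ, hφ, hφL, hφC⟩ := exists_eigenfunctional K cs hL
  set a := φ (intervalVec K cs _ _ (shortestElt cs I)) with ha
  have hφw : ∀ w ∈ leftInterval cs (shortestElt cs I) (longestElt cs J),
      φ (intervalVec K cs _ _ w) = heckeChar K C (heckeElt K cs w) * a := by
    intro w hw
    rw [← heckeElt_smul_shortestElt K cs ((mem_leftInterval_iff cs).mp hw).1, hφC]
  have ha0 : a ≠ 0 := by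
    intro h0
    apply hφ
    apply (IntervalModule.basis cs K _ _).ext
    intro w
    rw [basis_eq_intervalVec, hφw _ w.2, h0, mul_zero, LinearMap.zero_apply]
  -- For `i ∈ I` the generator `π_i` fixes `u_I`, where the functional is not zero.
  have hIC : I ⊆ C := by
    intro i hi
    by_contra hC
    have h1 := hφC (HeckeAlgebra.gen M K i) (intervalVec K cs _ _ (shortestElt cs I))
    rw [gen_smul_intervalVec K cs (LeftWeakLE.refl cs _),
      step_of_isLeftDescent cs (isLeftDescent_shortestElt cs hi), heckeChar_gen_of_notMem K hC,
      zero_mul] at h1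
    exact ha0 h1
  refine ⟨C, a⁻¹ • φ, hIC, ?_, fun x hx => by simp [hφL x hx], fun w hw => ?_⟩
  · have h1 := hφC (heckeElt K cs (shortestElt cs C)) (intervalVec K cs _ _ (shortestElt cs I))
    rw [heckeElt_smul_shortestElt K cs (by rwa [rightDescentSet_shortestElt]),
      heckeChar_shortestElt, one_mul] at h1
    by_contra hCJ
    rw [intervalVec_of_notMem K cs, map_zero] at h1
    · exact ha0 h1.symm
    · intro h
      have := ((mem_leftInterval_iff cs).mp h).2
      rw [rightDescentSet_shortestElt] at this
      exact hCJ this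
  · rw [LinearMap.smul_apply, hφw w hw, smul_eq_mul, mul_comm, mul_assoc, mul_inv_cancel₀ ha0,
      mul_one]

theorem exists_ne_zero_of_functional {I J C : Set B} (hIJ : I ⊆ J) (hIC : I ⊆ C)
    {φ : ProjModule cs K I J →ₗ[K] K}
    (hφ : ∀ w ∈ leftInterval cs (shortestElt cs I) (longestElt cs J),
        φ (intervalVec K cs _ _ w) = heckeChar K C (heckeElt K cs w)) : φ ≠ 0 := by
  intro h0
  have h1 := hφ _ (shortestElt_mem_leftInterval cs hIJ)
  obtain ⟨τ, hτ, e, hI⟩ := exists_word_shortestElt cs I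
  rw [h0, LinearMap.zero_apply, e, ← prod_map_gen K cs hτ, map_list_prod, List.map_map] at h1
  refine List.prod_ne_zero ?_ h1.symm
  simp only [List.mem_map, not_exists, not_and]
  intro i hi
  change heckeChar K C _ ≠ 0
  rw [heckeChar_gen_of_mem K (hIC (hI i hi))]
  exact one_ne_zero

/-- A proper `L` has a functional whose support lies in the parabolic subgroup of some `C ⊆ J =
D_R(w)`, hence below `w`. It factors through `B(u_I, w)`, so it kills the kernel together with `L`.
-/
theorem isProjectiveCover_projModule {I J : Set B} (hIJ : I ⊆ J) {w : W}
    (hw : rightDescentSet cs w = J) :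
    IsProjectiveCover (HeckeAlgebra M K) (ProjModule cs K I J)
      (IntervalModule cs K (shortestElt cs I) w) := by
  have hwv : LeftWeakLE cs w (longestElt cs J) := (le_longestElt_iff cs).mpr hw.subset
  refine ⟨projective_projModule K cs I J, intervalProj K cs _ _ w hwv,
    intervalProj_surjective K cs hwv, fun L hL => ?_⟩
  by_contra hne
  obtain ⟨C, φ, hIC, hCJ, hφL, hφ⟩ := exists_functional_of_ne_top K cs hne
  refine sup_ne_top_of_functional K cs (exists_ne_zero_of_functional K cs hIJ hIC hφ)
    (fun p hp => ?_) hφL hL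
  refine functional_eq_zero_of_mem_ker K cs hwv (fun x hx hxw => ?_) (LinearMap.mem_ker.mp hp)
  rw [hφ x hx]
  by_contra h
  exact hxw (leftWeakLE_of_heckeChar_ne_zero K cs h fun i hi => by
    have := hCJ hi
    rw [← hw] at this
    exact this)

theorem nontrivial_projModule {I J : Set B} (hIJ : I ⊆ J) :
    Nontrivial (ProjModule cs K I J) :=
  ⟨_, 0, intervalVec_ne_zero K cs (shortestElt_mem_leftInterval cs hIJ)⟩

/-- For `I = J` the set `C` must be `I`, so two proper submodules are killed by the same nonzero
functional and cannot be complementary. -/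
theorem isIndecomposable_self (I : Set B) :
    IsIndecomposable (HeckeAlgebra M K) (ProjModule cs K I I) := by
  refine ⟨nontrivial_projModule K cs Set.Subset.rfl, fun N L hNL => ?_⟩
  by_contra! h
  have hL : L ≠ ⊤ := fun hL => h.1 (by simpa [hL] using hNL.inf_eq_bot)
  have hN : N ≠ ⊤ := fun hN => h.2 (by simpa [hN] using hNL.inf_eq_bot)
  obtain ⟨C, φ, h1, h2, hφL, hφ⟩ := exists_functional_of_ne_top K cs hL
  obtain ⟨C', φ', h1', h2', hφN, hφ'⟩ := exists_functional_of_ne_top K cs hN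
  obtain rfl := Set.Subset.antisymm h1 h2
  obtain rfl := Set.Subset.antisymm h1' h2'
  have e : φ' = φ := by
    apply (IntervalModule.basis cs K _ _).ext
    intro x
    rw [basis_eq_intervalVec, hφ x x.2, hφ' x x.2]
  exact sup_ne_top_of_functional K cs
    (exists_ne_zero_of_functional K cs Set.Subset.rfl Set.Subset.rfl hφ) (e ▸ hφN) hφL
    hNL.sup_eq_top

end MainResults

/-! ### Indecomposability and direct sums -/

section DirectSumDecomposition

theorem isIndecomposable_of_equiv {R P Q : Type*} [Ring R] [AddCommGroup P] [Module R P]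
    [AddCommGroup Q] [Module R Q] (e : P ≃ₗ[R] Q) (h : IsIndecomposable R P) :
    IsIndecomposable R Q := by
  obtain ⟨h1, h2⟩ := h
  refine ⟨e.symm.toEquiv.nontrivial, fun N L hNL => ?_⟩
  have := h2 (N.comap e.toLinearMap) (L.comap e.toLinearMap)
    ((Submodule.orderIsoMapComap e).symm.isCompl hNL)
  refine this.imp (fun h => ?_) fun h => ?_
  · exact (Submodule.orderIsoMapComap e).symm.injective (h.trans (map_bot _).symm)
  · exact (Submodule.orderIsoMapComap e).symm.injective (h.trans (map_bot _).symm)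

/-- A direct sum with two nonzero summands is not indecomposable. -/
theorem not_isIndecomposable_directSum {R ι : Type*} [Ring R] (P : ι → Type*)
    [∀ i, AddCommGroup (P i)] [∀ i, Module R (P i)] {i j : ι} (hij : i ≠ j) [Nontrivial (P i)]
    [Nontrivial (P j)] : ¬ IsIndecomposable R (DirectSum ι P) := by
  classical
  rintro ⟨-, h⟩
  have hc : IsCompl (LinearMap.range (DirectSum.lof R ι P i))
      (LinearMap.ker (DirectSum.component R ι P i)) := by
    constructor
    · rw [Submodule.disjoint_def]
      rintro _ ⟨x, rfl⟩ hx
      rw [LinearMap.mem_ker, DirectSum.component.lof_self] at hx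
      rw [hx, map_zero]
    · rw [Submodule.codisjoint_iff_exists_add_eq]
      intro z
      refine ⟨_, z - DirectSum.lof R ι P i (DirectSum.component R ι P i z), ⟨_, rfl⟩, ?_,
        add_sub_cancel _ _⟩
      rw [LinearMap.mem_ker, map_sub, DirectSum.component.lof_self, sub_self]
  rcases h _ _ hc with h | h
  · obtain ⟨x, hx⟩ := exists_ne (0 : P i)
    have h1 : DirectSum.lof R ι P i x ∈ (⊥ : Submodule R (DirectSum ι P)) := h ▸ ⟨x, rfl⟩
    rw [Submodule.mem_bot] at h1
    apply hx
    rw [← DirectSum.component.lof_self (R := R) (M := P) (i := i) (b := x), h1, map_zero]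
  · obtain ⟨x, hx⟩ := exists_ne (0 : P j)
    have h1 : DirectSum.lof R ι P j x ∈ (⊥ : Submodule R (DirectSum ι P)) := by
      rw [← h, LinearMap.mem_ker, DirectSum.component.of, dif_neg hij.symm]
    rw [Submodule.mem_bot] at h1
    apply hx
    rw [← DirectSum.component.lof_self (R := R) (M := P) (i := j) (b := x), h1, map_zero]

end DirectSumDecomposition

end ZeroHecke

theorem mainTheorem6 {B W : Type*} [Group W] [Finite W] {M : CoxeterMatrix B}
    (cs : CoxeterSystem M W) (K : Type*) [Field K] (I J : Set B) (hIJ : I ⊆ J)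
    (w : W) (hw : w ∈ ZeroHecke.descentClass cs J) :
    Nonempty (ZeroHecke.ProjModule cs K I J ≃ₗ[ZeroHecke.HeckeAlgebra M K]
        DirectSum {X : Set B // I ⊆ X ∧ X ⊆ J} fun X => ZeroHecke.ProjModule cs K X.1 X.1) ∧
      ZeroHecke.IsProjectiveCover (ZeroHecke.HeckeAlgebra M K) (ZeroHecke.ProjModule cs K I J)
        (ZeroHecke.IntervalModule cs K (ZeroHecke.shortestElt cs I) w) ∧
      (ZeroHecke.IsIndecomposable (ZeroHecke.HeckeAlgebra M K) (ZeroHecke.ProjModule cs K I J) ↔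
        I = J) := by
  refine ⟨⟨(ZeroHecke.sumEquiv K cs I J).symm⟩,
    ZeroHecke.isProjectiveCover_projModule K cs hIJ hw, fun h => ?_, ?_⟩
  · by_contra hne
    let i : {X : Set B // I ⊆ X ∧ X ⊆ J} := ⟨I, Set.Subset.rfl, hIJ⟩
    let j : {X : Set B // I ⊆ X ∧ X ⊆ J} := ⟨J, hIJ, Set.Subset.rfl⟩
    have hij : i ≠ j := fun h => hne (congrArg Subtype.val h)
    have := ZeroHecke.nontrivial_projModule K cs (I := i.1) (J := i.1) Set.Subset.rfl
    have := ZeroHecke.nontrivial_projModule K cs (I := j.1) (J := j.1) Set.Subset.rfl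
    exact ZeroHecke.not_isIndecomposable_directSum
      (fun X : {X : Set B // I ⊆ X ∧ X ⊆ J} => ZeroHecke.ProjModule cs K X.1 X.1) hij
      (ZeroHecke.isIndecomposable_of_equiv (ZeroHecke.sumEquiv K cs I J).symm h)
  · rintro rfl
    exact ZeroHecke.isIndecomposable_self K cs I
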